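/- Let $p$ be a prime, $L/\mathbb{Q}_p$ a finite extension with ring of integers $\mathcal{O}_L$, uniformizer $\pi$ and residue field $\mathbb{F}_q=\mathcal{O}_L/\pi$. **Definitions.** A $\delta_L$-algebra is an $\mathcal{O}_L$-algebra $A$ with a map of sets $\delta_L:A\to A$ such that $\delta_L(\alpha)=\frac{\alpha-\alpha^q}{\pi}$ for $\alpha\in\mathcal{O}_L$, $\delta_L(xy)=\delta_L(x)y^q+x^q\delta_L(y)+\pi\delta_L(x)\delta_L(y)$, and $\delta_L(x+y)=\delta_L(x)+\delta_L(y)-\sum_{i=1}^{q-1}\frac1\pi\binom qi x^iy^{q-i}$ for $x,y\in A$; put $\phi_A(x)=x^q+\pi\delta_L(x)$. It is perfect if $\phi_A$ is bijective. An $L$-typical prism is a pair $(A,I)$ with $A$ a $\delta_L$-algebra and $I\subseteq A$ an ideal that is Zariski-locally generated by a nonzerodivisor, such that $A$ is derived $(\pi,I)$-complete and $\pi\in I+\phi_A(I)A$; it is perfect if $A$ is. A morphism $(A,I)\to(B,J)$ is an $\mathcal{O}_L$-algebra map $f:A\to B$ that commutes with $\delta_L$ and satisfies $f(I)\subseteq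 J$. An $\mathcal{O}_L$-algebra is called perfectoid if it is isomorphic, as an $\mathcal{O}_L$-algebra, to $A/I$ for some perfect $L$-typical prism $(A,I)$; morphisms of perfectoid $\mathcal{O}_L$-algebras are $\mathcal{O}_L$-algebra maps. For an $\mathcal{O}_L$-algebra $R$ let $R^\flat=\varprojlim_{x\mapsto x^q}R/\pi$ be its tilt, and let $A_{\inf}(R)=W_L(R^\flat)$, where $W_L$ denotes the ramified Witt vectors attached to the ghost polynomials $w_n=X_0^{q^n}+\pi X_1^{q^{n-1}}+\dots+\pi^nX_n$, with their canonical $\delta_L$-structure, for which $\phi$ is the Witt vector Frobenius. If $R$ is $\pi$-adically complete, let $\theta:A_{\inf}(R)\to R$ be the $\mathcal{O}_L$-algebra map given in Witt coordinates by $(x_0,x_1,\dots)\mapsto\sum_{n\ge0}\bigl(x_n^{1/q^n}\bigr)^\sharp\pi^n$, where $x^\sharp=\lim_n\widehat{x_n}^{\,q^n}$ for $x=(\dots,x_1,x_0)\in R^\flat$ and arbitrary lifts $\widehat{x_n}\in R$ of $x_n\in R/\pi$. **Theorem.** The functor $(A,I)\mapsto A/I$ is an equivalence from the category of perfect $L$-typical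 prisms to the category of perfectoid $\mathcal{O}_L$-algebras. Every perfectoid $\mathcal{O}_L$-algebra $R$ is $\pi$-adically complete, the pair $(A_{\inf}(R),\ker\theta)$ is a perfect $L$-typical prism, and the functor $R\mapsto(A_{\inf}(R),\ker\theta)$ is a quasi-inverse: there are natural isomorphisms $A_{\inf}(R)/\ker\theta\cong R$, induced by $\theta$, and $(A,I)\cong(A_{\inf}(A/I),\ker\theta)$, whose composite with $\theta$ is the projection $A\to A/I$. -/

import Mathlib

open CategoryTheory

universe v u

namespace LTypical

noncomputable section

section Base

variable {O : Type v} [CommRing O]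

/-- `π` is a nonzerodivisor generating a maximal ideal with finite residue field. -/
class IsUniformizer (π : O) : Prop where
  regular : ∀ a : O, π * a = 0 → a = 0
  isMaximal : (Ideal.span {π}).IsMaximal
  finite : Finite (O ⧸ Ideal.span {π})

/-- The cardinality `q` of the residue field `O / π`. -/
def resCard (π : O) : ℕ := Nat.card (O ⧸ Ideal.span {π})

variable (π : O) [IsUniformizer π]

theorem two_le_resCard : 2 ≤ resCard π := by
  have := IsUniformizer.isMaximal (π := π)
  have := IsUniformizer.finite (π := π)
  have : Nontrivial (O ⧸ Ideal.span {π}) :=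
    Ideal.Quotient.nontrivial_iff.2 (IsUniformizer.isMaximal (π := π)).ne_top
  exact Finite.one_lt_card

theorem dvd_pow_resCard_sub (a : O) : π ∣ a ^ resCard π - a := by
  have := IsUniformizer.isMaximal (π := π)
  have := IsUniformizer.finite (π := π)
  let _ := Ideal.Quotient.field (Ideal.span {π})
  let _ := Fintype.ofFinite (O ⧸ Ideal.span {π})
  rw [← Ideal.mem_span_singleton, ← Ideal.Quotient.eq_zero_iff_mem, map_sub, map_pow, resCard,
    Nat.card_eq_fintype_card, FiniteField.pow_card, sub_self]

theorem dvd_sub_pow_resCard (a : O) : π ∣ a - a ^ resCard π := by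
  rw [← dvd_neg, neg_sub]; exact dvd_pow_resCard_sub π a

theorem dvd_choose {i : ℕ} (h0 : i ≠ 0) (hi : i ≠ resCard π) :
    π ∣ ((resCard π).choose i : O) := by
  have := IsUniformizer.isMaximal (π := π)
  have := IsUniformizer.finite (π := π)
  let _ := Ideal.Quotient.field (Ideal.span {π})
  let _ := Fintype.ofFinite (O ⧸ Ideal.span {π})
  obtain ⟨p, hc⟩ := CharP.exists (O ⧸ Ideal.span {π})
  obtain ⟨n, hp, hn⟩ := FiniteField.card (O ⧸ Ideal.span {π}) p
  rw [← Ideal.mem_span_singleton, ← Ideal.Quotient.eq_zero_iff_mem, map_natCast,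
    CharP.cast_eq_zero_iff (O ⧸ Ideal.span {π}) p]
  rw [resCard, Nat.card_eq_fintype_card, hn] at hi ⊢
  exact hp.dvd_choose_pow h0 hi

/-- The quotient `a / b` whenever `b` divides `a`. -/
def divBy {B : Type*} [CommRing B] (b a : B) : B :=
  open Classical in if h : b ∣ a then h.choose else 0

theorem mul_divBy {B : Type*} [CommRing B] {b a : B} (h : b ∣ a) : b * divBy b a = a := by
  rw [divBy, dif_pos h]; exact h.choose_spec.symm

/-- `∑_{0 < i < q} (1/π) (q choose i) xⁱ y^(q-i)`, i.e. `((x + y)^q - x^q - y^q) / π`. -/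
def binomSum {A : Type*} [CommRing A] [Algebra O A] (x y : A) : A :=
  ∑ i ∈ Finset.Ioo 0 (resCard π),
    algebraMap O A (divBy π ((resCard π).choose i : O)) * x ^ i * y ^ (resCard π - i)

theorem mul_binomSum {A : Type*} [CommRing A] [Algebra O A] (x y : A) :
    algebraMap O A π * binomSum π x y =
      (x + y) ^ resCard π - x ^ resCard π - y ^ resCard π := by
  have h2 := two_le_resCard π
  have h : ∀ i ∈ Finset.Ioo 0 (resCard π),
      algebraMap O A π * (algebraMap O A (divBy π ((resCard π).choose i : O)) * x ^ i *
        y ^ (resCard π - i)) = x ^ i * y ^ (resCard π - i) * (resCard π).choose i := by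
    intro i hi
    rw [Finset.mem_Ioo] at hi
    have : algebraMap O A π * algebraMap O A (divBy π ((resCard π).choose i : O)) =
        (resCard π).choose i := by
      rw [← map_mul, mul_divBy (dvd_choose π (by omega) (by omega)), map_natCast]
    rw [← this]; ring
  rw [binomSum, Finset.mul_sum, Finset.sum_congr rfl h, add_pow]
  obtain ⟨m, hm⟩ : ∃ m, resCard π = m + 1 := ⟨resCard π - 1, by omega⟩
  rw [Finset.sum_range_succ, hm, Finset.range_eq_Ico, Finset.sum_eq_sum_Ico_succ_bot (by omega)]
  have : Finset.Ioo 0 (m + 1) = Finset.Ico (0 + 1) (m + 1) := by ext; simp; omega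
  rw [this]
  simp

theorem dvd_pow_sub_pow {A : Type*} [CommRing A] [Algebra O A] {a b : A} {m : ℕ}
    (hm : m ≠ 0) (h : algebraMap O A π ^ m ∣ a - b) :
    algebraMap O A π ^ (m + 1) ∣ a ^ resCard π - b ^ resCard π := by
  have h2 := two_le_resCard π
  obtain ⟨c, hc⟩ := h
  have e := mul_binomSum π (a - b) b
  have hb : a - b ∣ binomSum π (a - b) b := by
    refine Finset.dvd_sum fun i hi => ?_
    rw [Finset.mem_Ioo] at hi
    exact (Dvd.dvd.mul_left (dvd_pow_self _ (by omega)) _).mul_right _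
  obtain ⟨d, hd⟩ := hb
  have e' : a ^ resCard π - b ^ resCard π =
      algebraMap O A π * binomSum π (a - b) b + (a - b) ^ resCard π := by
    rw [e, sub_add_cancel]; ring
  rw [e', hd, hc]
  refine dvd_add ⟨c * d, by ring⟩ ?_
  rw [mul_pow, ← pow_mul]
  refine Dvd.dvd.mul_right (pow_dvd_pow _ ?_) _
  nlinarith [Nat.one_le_iff_ne_zero.2 hm]

theorem dvd_pow_pow_sub_pow_pow {A : Type*} [CommRing A] [Algebra O A] {a b : A}
    (h : algebraMap O A π ∣ a - b) (k : ℕ) :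
    algebraMap O A π ^ (k + 1) ∣ a ^ resCard π ^ k - b ^ resCard π ^ k := by
  induction k with
  | zero => simpa using h
  | succ k ih =>
    rw [pow_succ (resCard π), pow_mul, pow_mul]
    exact dvd_pow_sub_pow π (by omega) ih

end Base

section Ghost

variable {O : Type v} [CommRing O] (π : O)

/-- The ghost polynomial `x₀^(qⁿ) + π x₁^(qⁿ⁻¹) + ⋯ + πⁿ xₙ`. -/
def ghostSeq {R : Type*} [CommRing R] [Algebra O R] (n : ℕ) (x : ℕ → R) : R :=
  ∑ i ∈ Finset.range (n + 1), algebraMap O R π ^ i * x i ^ resCard π ^ (n - i)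

theorem ghostSeq_map {R S : Type*} [CommRing R] [Algebra O R] [CommRing S] [Algebra O S]
    (f : R →ₐ[O] S) (n : ℕ) (x : ℕ → R) :
    ghostSeq π n (fun i => f (x i)) = f (ghostSeq π n x) := by
  simp [ghostSeq, map_sum, map_mul, map_pow]

theorem ghostSeq_succ {R : Type*} [CommRing R] [Algebra O R] (n : ℕ) (x : ℕ → R) :
    ghostSeq π (n + 1) x =
      ghostSeq π n (fun i => x i ^ resCard π) + algebraMap O R π ^ (n + 1) * x (n + 1) := by
  rw [ghostSeq, Finset.sum_range_succ, Nat.sub_self, pow_zero, pow_one, ghostSeq]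
  congr 1
  refine Finset.sum_congr rfl fun i hi => ?_
  rw [Finset.mem_range] at hi
  rw [← pow_mul, ← pow_succ', show n + 1 - i = n - i + 1 by omega]

theorem ghostSeq_congr [IsUniformizer π] {R : Type*} [CommRing R] [Algebra O R] (n : ℕ)
    {x y : ℕ → R} (h : ∀ i, algebraMap O R π ∣ x i - y i) :
    algebraMap O R π ^ (n + 1) ∣ ghostSeq π n x - ghostSeq π n y := by
  rw [ghostSeq, ghostSeq, ← Finset.sum_sub_distrib]
  refine Finset.dvd_sum fun i hi => ?_
  rw [Finset.mem_range] at hi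
  rw [← mul_sub]
  have := mul_dvd_mul_left (algebraMap O R π ^ i) (dvd_pow_pow_sub_pow_pow π (h i) (n - i))
  rwa [← pow_add, show i + (n - i + 1) = n + 1 by omega] at this

theorem ghostSeq_injective {R : Type*} [CommRing R] [Algebra O R]
    (hreg : ∀ b : R, algebraMap O R π * b = 0 → b = 0) {x y : ℕ → R}
    (h : ∀ n, ghostSeq π n x = ghostSeq π n y) : x = y := by
  have hreg' : ∀ (n : ℕ) (b : R), algebraMap O R π ^ n * b = 0 → b = 0 := by
    intro n
    induction n with
    | zero => intro b hb; simpa using hb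
    | succ n ih => intro b hb; rw [pow_succ, mul_assoc] at hb; exact hreg _ (ih _ hb)
  funext n
  induction n using Nat.strong_induction_on with
  | _ n ih =>
    have e := h n
    rw [ghostSeq, ghostSeq, Finset.sum_range_succ, Finset.sum_range_succ,
      Finset.sum_congr rfl fun i hi => by rw [ih i (Finset.mem_range.1 hi)]] at e
    have e' := add_left_cancel e
    rw [Nat.sub_self, pow_zero, pow_one, pow_one] at e'
    exact sub_eq_zero.1 (hreg' n _ (by rw [mul_sub, e', sub_self]))

/-- The sequence with prescribed ghost components `a` (when it exists), solved recursively. -/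
def ghostInv {B : Type*} [CommRing B] [Algebra O B] (a : ℕ → B) : ℕ → B
  | n => divBy (algebraMap O B π ^ n)
      (a n - ∑ i : Fin n, algebraMap O B π ^ (i : ℕ) *
        ghostInv a (i : ℕ) ^ resCard π ^ (n - i))
decreasing_by exact i.2

theorem ghostInv_eq {B : Type*} [CommRing B] [Algebra O B] (a : ℕ → B) (n : ℕ) :
    ghostInv π a n = divBy (algebraMap O B π ^ n)
      (a n - ∑ i : Fin n, algebraMap O B π ^ (i : ℕ) *
        ghostInv π a (i : ℕ) ^ resCard π ^ (n - i)) := by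
  rw [ghostInv]

theorem ghostSeq_sub_dvd [IsUniformizer π] {B : Type*} [CommRing B] [Algebra O B] (ψ : B →ₐ[O] B)
    (hψ : ∀ b, algebraMap O B π ∣ ψ b - b ^ resCard π) (n : ℕ) (x : ℕ → B) :
    algebraMap O B π ^ (n + 1) ∣ ghostSeq π (n + 1) x - ψ (ghostSeq π n x) := by
  rw [ghostSeq_succ, ← ghostSeq_map, add_sub_right_comm]
  refine dvd_add (ghostSeq_congr π n fun i => ?_) (dvd_mul_right _ _)
  rw [← dvd_neg, neg_sub]; exact hψ _

theorem ghostSeq_ghostInv [IsUniformizer π] {B : Type*} [CommRing B] [Algebra O B] (ψ : B →ₐ[O] B)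
    (hψ : ∀ b, algebraMap O B π ∣ ψ b - b ^ resCard π) (a : ℕ → B)
    (ha : ∀ n, algebraMap O B π ^ (n + 1) ∣ a (n + 1) - ψ (a n)) (n : ℕ) :
    ghostSeq π n (ghostInv π a) = a n := by
  have key : ∀ n, algebraMap O B π ^ n ∣ (a n - ∑ i : Fin n, algebraMap O B π ^ (i : ℕ) *
        ghostInv π a (i : ℕ) ^ resCard π ^ (n - i)) → ghostSeq π n (ghostInv π a) = a n := by
    intro n h
    rw [ghostSeq, Finset.sum_range_succ, Nat.sub_self, pow_zero, pow_one]
    rw [ghostInv_eq π a n, mul_divBy h, Finset.sum_range]; ring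
  induction n with
  | zero => exact key 0 (by simp)
  | succ n ih =>
    refine key (n + 1) ?_
    have e : ∑ i : Fin (n + 1), algebraMap O B π ^ (i : ℕ) *
        ghostInv π a (i : ℕ) ^ resCard π ^ (n + 1 - i) =
        ghostSeq π n (fun i => ghostInv π a i ^ resCard π) := by
      rw [ghostSeq, Finset.sum_range]
      refine Finset.sum_congr rfl fun i _ => ?_
      rw [← pow_mul, ← pow_succ', show n + 1 - (i : ℕ) = n - i + 1 by omega]
    rw [e]
    have h1 := ghostSeq_sub_dvd π ψ hψ n (ghostInv π a)
    rw [ghostSeq_succ, ih] at h1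
    have h2 := dvd_sub (ha n) h1
    have h3 : a (n + 1) - ghostSeq π n (fun i => ghostInv π a i ^ resCard π) =
      (a (n + 1) - ψ (a n) - (ghostSeq π n (fun i => ghostInv π a i ^ resCard π) +
        algebraMap O B π ^ (n + 1) * ghostInv π a (n + 1) - ψ (a n))) +
        algebraMap O B π ^ (n + 1) * ghostInv π a (n + 1) := by ring
    rw [h3]
    exact dvd_add h2 (dvd_mul_right _ _)

theorem expand_sub_dvd [IsUniformizer π] {σ : Type*} (b : MvPolynomial σ O) :
    algebraMap O (MvPolynomial σ O) π ∣ MvPolynomial.expand (resCard π) b - b ^ resCard π := by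
  induction b using MvPolynomial.induction_on with
  | C a =>
    rw [MvPolynomial.expand_C, ← map_pow, ← map_sub]
    exact map_dvd MvPolynomial.C (dvd_sub_pow_resCard π a)
  | add x y hx hy =>
    have := mul_binomSum π x y
    rw [map_add, show MvPolynomial.expand (resCard π) x + MvPolynomial.expand (resCard π) y -
      (x + y) ^ resCard π = (MvPolynomial.expand (resCard π) x - x ^ resCard π) +
      (MvPolynomial.expand (resCard π) y - y ^ resCard π) - ((x + y) ^ resCard π - x ^ resCard π -
      y ^ resCard π) by ring, ← this]
    exact dvd_sub (dvd_add hx hy) (dvd_mul_right _ _)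
  | mul_X x i hx =>
    rw [map_mul, MvPolynomial.expand_X, mul_pow, ← sub_mul]
    exact hx.mul_right _

theorem mvPolynomial_regular [IsUniformizer π] {σ : Type*} (b : MvPolynomial σ O)
    (h : algebraMap O (MvPolynomial σ O) π * b = 0) : b = 0 := by
  ext m
  have := congrArg (MvPolynomial.coeff m) h
  rw [MvPolynomial.algebraMap_eq, MvPolynomial.coeff_C_mul, MvPolynomial.coeff_zero] at this
  simpa using IsUniformizer.regular _ this

/-- The generic ghost component, a polynomial in variables `X i`. -/
abbrev ghostX {σ : Type*} (v : ℕ → σ) (n : ℕ) : MvPolynomial σ O :=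
  ghostSeq π n fun i => MvPolynomial.X (v i)

/-- The polynomials giving addition of ramified Witt vectors. -/
def addPoly : ℕ → MvPolynomial (Fin 2 × ℕ) O :=
  ghostInv π fun n => ghostX π (Prod.mk 0) n + ghostX π (Prod.mk 1) n

/-- The polynomials giving multiplication of ramified Witt vectors. -/
def mulPoly : ℕ → MvPolynomial (Fin 2 × ℕ) O :=
  ghostInv π fun n => ghostX π (Prod.mk 0) n * ghostX π (Prod.mk 1) n

/-- The polynomials giving negation of ramified Witt vectors. -/
def negPoly : ℕ → MvPolynomial ℕ O := ghostInv π fun n => - ghostX π id n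

/-- The Witt coordinates of a scalar, all of whose ghost components are `α`. -/
def constSeq (α : O) : ℕ → O := ghostInv π fun _ => α

/-- The polynomials giving `δ_L = (F - (·)^q) / π` on ramified Witt vectors. -/
def deltaPoly : ℕ → MvPolynomial ℕ O :=
  ghostInv π fun n => divBy (algebraMap O _ π) (ghostX π id (n + 1) - ghostX π id n ^ resCard π)

variable [IsUniformizer π]

theorem ghostSeq_addPoly (n : ℕ) :
    ghostSeq π n (addPoly π) = ghostX π (Prod.mk 0) n + ghostX π (Prod.mk 1) n := by
  refine ghostSeq_ghostInv π _ (expand_sub_dvd π) _ (fun n => ?_) n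
  rw [map_add, add_sub_add_comm]
  exact dvd_add (ghostSeq_sub_dvd π _ (expand_sub_dvd π) _ _)
    (ghostSeq_sub_dvd π _ (expand_sub_dvd π) _ _)

theorem ghostSeq_mulPoly (n : ℕ) :
    ghostSeq π n (mulPoly π) = ghostX π (Prod.mk 0) n * ghostX π (Prod.mk 1) n := by
  refine ghostSeq_ghostInv π _ (expand_sub_dvd π) _ (fun n => ?_) n
  rw [map_mul]
  have h0 := ghostSeq_sub_dvd π _ (expand_sub_dvd π) n
    fun i => (MvPolynomial.X (0, i) : MvPolynomial (Fin 2 × ℕ) O)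
  have h1 := ghostSeq_sub_dvd π _ (expand_sub_dvd π) n
    fun i => (MvPolynomial.X (1, i) : MvPolynomial (Fin 2 × ℕ) O)
  have := dvd_add (h0.mul_right (ghostX π (Prod.mk 1) (n + 1)))
    (h1.mul_left (MvPolynomial.expand (resCard π) (ghostX π (Prod.mk 0) n)))
  refine this.trans (dvd_of_eq ?_)
  simp only [ghostX]; ring

theorem ghostSeq_negPoly (n : ℕ) : ghostSeq π n (negPoly π) = - ghostX π id n := by
  refine ghostSeq_ghostInv π _ (expand_sub_dvd π) _ (fun n => ?_) n
  rw [map_neg, ← neg_sub', dvd_neg]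
  exact ghostSeq_sub_dvd π _ (expand_sub_dvd π) _ _

theorem ghostSeq_constSeq (α : O) (n : ℕ) : ghostSeq π n (constSeq π α) = α := by
  refine ghostSeq_ghostInv π (AlgHom.id O O) (dvd_sub_pow_resCard π) _ (fun n => ?_) n
  simp

theorem mul_ghostSeq_deltaPoly (n : ℕ) :
    algebraMap O _ π * ghostSeq π n (deltaPoly π) =
      ghostX π id (n + 1) - ghostX π id n ^ resCard π := by
  have hd : ∀ n, algebraMap O (MvPolynomial ℕ O) π ∣
      ghostX π id (n + 1) - ghostX π id n ^ resCard π := by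
    intro n
    have h1 := (dvd_pow_self _ n.succ_ne_zero).trans
      (ghostSeq_sub_dvd π _ (expand_sub_dvd π) n fun i => (MvPolynomial.X i : MvPolynomial ℕ O))
    have := dvd_add h1 (expand_sub_dvd π (ghostX π id n))
    exact this.trans (dvd_of_eq (by simp only [ghostX, id]; ring))
  rw [deltaPoly, ghostSeq_ghostInv π _ (expand_sub_dvd π) _ ?_ n, mul_divBy (hd n)]
  intro n
  obtain ⟨c, hc⟩ : algebraMap O (MvPolynomial ℕ O) π ^ (n + 2) ∣
      algebraMap O _ π * (divBy (algebraMap O _ π) (ghostX π id (n + 1 + 1) -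
          ghostX π id (n + 1) ^ resCard π) -
        MvPolynomial.expand (resCard π) (divBy (algebraMap O _ π)
          (ghostX π id (n + 1) - ghostX π id n ^ resCard π))) := by
    rw [mul_sub, mul_divBy (hd _),
      ← AlgHom.commutes (MvPolynomial.expand (R := O) (σ := ℕ) (resCard π)), ← map_mul,
      AlgHom.commutes, mul_divBy (hd _), map_sub, map_pow, sub_sub_sub_comm]
    exact dvd_sub (ghostSeq_sub_dvd π _ (expand_sub_dvd π) _ _)
      (dvd_pow_sub_pow π (by omega) (ghostSeq_sub_dvd π _ (expand_sub_dvd π) _ _))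
  refine ⟨c, sub_eq_zero.1 (mvPolynomial_regular π _ ?_)⟩
  rw [mul_sub, hc]; ring

end Ghost

section Witt

variable {O : Type v} [CommRing O]

/-- The ramified Witt vectors `W_L(R)`; as a set, sequences in `R`. -/
@[ext]
structure Witt (π : O) (R : Type u) where
  coeff : ℕ → R

namespace Witt

variable {π : O}

section Ops

variable {R : Type u} [CommRing R] [Algebra O R]

instance : Add (Witt π R) :=
  ⟨fun x y => ⟨fun n => MvPolynomial.aeval (fun v => ![x.coeff, y.coeff] v.1 v.2) (addPoly π n)⟩⟩

instance : Mul (Witt π R) :=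
  ⟨fun x y => ⟨fun n => MvPolynomial.aeval (fun v => ![x.coeff, y.coeff] v.1 v.2) (mulPoly π n)⟩⟩

instance : Neg (Witt π R) := ⟨fun x => ⟨fun n => MvPolynomial.aeval x.coeff (negPoly π n)⟩⟩

/-- The scalar `α`, with all ghost components equal to `α`. -/
def const (α : O) : Witt π R := ⟨fun n => algebraMap O R (constSeq π α n)⟩

instance : Zero (Witt π R) := ⟨const 0⟩

instance : One (Witt π R) := ⟨const 1⟩

/-- The map `δ_L` on ramified Witt vectors. -/
def delta (x : Witt π R) : Witt π R := ⟨fun n => MvPolynomial.aeval x.coeff (deltaPoly π n)⟩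

/-- The `n`-th ghost component. -/
def ghost (n : ℕ) (x : Witt π R) : R := ghostSeq π n x.coeff

/-- The map on ramified Witt vectors induced by a map of algebras, coordinatewise. -/
def mapFun {S : Type*} [CommRing S] [Algebra O S] (f : R →ₐ[O] S) (x : Witt π R) : Witt π S :=
  ⟨fun n => f (x.coeff n)⟩

end Ops

theorem ghost_ext {R : Type*} [CommRing R] [Algebra O R]
    (hreg : ∀ b : R, algebraMap O R π * b = 0 → b = 0) {x y : Witt π R}
    (h : ∀ n, ghost n x = ghost n y) : x = y :=
  Witt.ext (ghostSeq_injective π hreg h)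

section Ghost

variable {R : Type*} [CommRing R] [Algebra O R] [IsUniformizer π] (n : ℕ)

theorem ghost_add (x y : Witt π R) : ghost n (x + y) = ghost n x + ghost n y := by
  have := congrArg (MvPolynomial.aeval fun v : Fin 2 × ℕ => ![x.coeff, y.coeff] v.1 v.2)
    (ghostSeq_addPoly π n)
  rw [map_add, ghostX, ghostX, ← ghostSeq_map, ← ghostSeq_map, ← ghostSeq_map] at this
  simp only [MvPolynomial.aeval_X] at this
  exact this

theorem ghost_mul (x y : Witt π R) : ghost n (x * y) = ghost n x * ghost n y := by
  have := congrArg (MvPolynomial.aeval fun v : Fin 2 × ℕ => ![x.coeff, y.coeff] v.1 v.2)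
    (ghostSeq_mulPoly π n)
  rw [map_mul, ghostX, ghostX, ← ghostSeq_map, ← ghostSeq_map, ← ghostSeq_map] at this
  simp only [MvPolynomial.aeval_X] at this
  exact this

theorem ghost_neg (x : Witt π R) : ghost n (-x) = - ghost n x := by
  have := congrArg (MvPolynomial.aeval x.coeff) (ghostSeq_negPoly π n)
  rw [map_neg, ghostX, ← ghostSeq_map, ← ghostSeq_map] at this
  simp only [MvPolynomial.aeval_X] at this
  exact this

theorem ghost_const (α : O) : ghost n (const α : Witt π R) = algebraMap O R α := by
  have := congrArg (Algebra.ofId O R) (ghostSeq_constSeq π α n)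
  rwa [← ghostSeq_map] at this

theorem ghost_zero : ghost n (0 : Witt π R) = 0 := 
  (ghost_const n 0).trans (map_zero _)

theorem ghost_one : ghost n (1 : Witt π R) = 1 := 
  (ghost_const n 1).trans (map_one _)

theorem ghost_delta (x : Witt π R) :
    algebraMap O R π * ghost n (delta x) = ghost (n + 1) x - ghost n x ^ resCard π := by
  have := congrArg (MvPolynomial.aeval x.coeff) (mul_ghostSeq_deltaPoly π n)
  rw [map_mul, map_sub, map_pow, AlgHom.commutes, ghostX, ghostX,
    ← ghostSeq_map, ← ghostSeq_map, ← ghostSeq_map] at this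
  simp only [MvPolynomial.aeval_X] at this
  exact this

end Ghost

section Map

variable {R S : Type*} [CommRing R] [Algebra O R] [CommRing S] [Algebra O S] (f : R →ₐ[O] S)

theorem aeval_two (x y : Witt π R) (P : MvPolynomial (Fin 2 × ℕ) O) :
    MvPolynomial.aeval (fun v : Fin 2 × ℕ => ![(mapFun f x).coeff, (mapFun f y).coeff] v.1 v.2) P =
      f (MvPolynomial.aeval (fun v : Fin 2 × ℕ => ![x.coeff, y.coeff] v.1 v.2) P) := by
  rw [← AlgHom.comp_apply, MvPolynomial.comp_aeval]
  congr 2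
  funext ⟨i, n⟩
  fin_cases i <;> rfl

theorem mapFun_add (x y : Witt π R) : mapFun f (x + y) = mapFun f x + mapFun f y :=
  Witt.ext (funext fun n => (aeval_two f x y (addPoly π n)).symm)

theorem mapFun_mul (x y : Witt π R) : mapFun f (x * y) = mapFun f x * mapFun f y :=
  Witt.ext (funext fun n => (aeval_two f x y (mulPoly π n)).symm)

theorem mapFun_neg (x : Witt π R) : mapFun f (-x) = -mapFun f x :=
  Witt.ext (funext fun n => by
    change f (MvPolynomial.aeval _ _) = _
    rw [← AlgHom.comp_apply, MvPolynomial.comp_aeval]; rfl)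

theorem mapFun_delta (x : Witt π R) : mapFun f (delta x) = delta (mapFun f x) :=
  Witt.ext (funext fun n => by
    change f (MvPolynomial.aeval _ _) = _
    rw [← AlgHom.comp_apply, MvPolynomial.comp_aeval]; rfl)

theorem mapFun_const (α : O) : mapFun f (const α : Witt π R) = const α :=
  Witt.ext (funext fun _ => f.commutes _)

theorem mapFun_zero : mapFun f (0 : Witt π R) = 0 := mapFun_const f 0

theorem mapFun_one : mapFun f (1 : Witt π R) = 1 := mapFun_const f 1

/-- Every ramified Witt vector lifts to one over a polynomial ring over `O`. -/
theorem exists_lift (x : Witt π R) :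
    ∃ y : Witt π (MvPolynomial R O), mapFun (MvPolynomial.aeval id) y = x :=
  ⟨⟨fun n => MvPolynomial.X (x.coeff n)⟩, Witt.ext (funext fun n => by simp [mapFun])⟩

theorem const_eq_map {R : Type*} [CommRing R] [Algebra O R] (α : O) :
    (const α : Witt π R) = mapFun (Algebra.ofId O R) (const α : Witt π O) :=
  (mapFun_const _ α).symm

end Map

variable {R : Type u} [CommRing R] [Algebra O R] [IsUniformizer π]

instance : CommRing (Witt π R) where
  add_assoc x y z := by
    obtain ⟨x, rfl⟩ := exists_lift x; obtain ⟨y, rfl⟩ := exists_lift y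
    obtain ⟨z, rfl⟩ := exists_lift z
    simp only [← mapFun_add]
    exact congrArg _ (ghost_ext (mvPolynomial_regular π) fun n => by simp only [ghost_add]; ring)
  zero_add x := by
    obtain ⟨x, rfl⟩ := exists_lift x
    rw [← mapFun_zero (MvPolynomial.aeval id : MvPolynomial R O →ₐ[O] R), ← mapFun_add]
    exact congrArg _ (ghost_ext (mvPolynomial_regular π) fun n => by
      simp only [ghost_add, ghost_zero]; ring)
  add_zero x := by
    obtain ⟨x, rfl⟩ := exists_lift x
    rw [← mapFun_zero (MvPolynomial.aeval id : MvPolynomial R O →ₐ[O] R), ← mapFun_add]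
    exact congrArg _ (ghost_ext (mvPolynomial_regular π) fun n => by
      simp only [ghost_add, ghost_zero]; ring)
  add_comm x y := by
    obtain ⟨x, rfl⟩ := exists_lift x; obtain ⟨y, rfl⟩ := exists_lift y
    simp only [← mapFun_add]
    exact congrArg _ (ghost_ext (mvPolynomial_regular π) fun n => by simp only [ghost_add]; ring)
  neg_add_cancel x := by
    obtain ⟨x, rfl⟩ := exists_lift x
    rw [← mapFun_zero (MvPolynomial.aeval id : MvPolynomial R O →ₐ[O] R), ← mapFun_neg,
      ← mapFun_add]
    exact congrArg _ (ghost_ext (mvPolynomial_regular π) fun n => by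
      simp only [ghost_add, ghost_zero, ghost_neg]; ring)
  mul_assoc x y z := by
    obtain ⟨x, rfl⟩ := exists_lift x; obtain ⟨y, rfl⟩ := exists_lift y
    obtain ⟨z, rfl⟩ := exists_lift z
    simp only [← mapFun_mul]
    exact congrArg _ (ghost_ext (mvPolynomial_regular π) fun n => by simp only [ghost_mul]; ring)
  mul_comm x y := by
    obtain ⟨x, rfl⟩ := exists_lift x; obtain ⟨y, rfl⟩ := exists_lift y
    simp only [← mapFun_mul]
    exact congrArg _ (ghost_ext (mvPolynomial_regular π) fun n => by simp only [ghost_mul]; ring)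
  one_mul x := by
    obtain ⟨x, rfl⟩ := exists_lift x
    rw [← mapFun_one (MvPolynomial.aeval id : MvPolynomial R O →ₐ[O] R), ← mapFun_mul]
    exact congrArg _ (ghost_ext (mvPolynomial_regular π) fun n => by
      simp only [ghost_mul, ghost_one]; ring)
  mul_one x := by
    obtain ⟨x, rfl⟩ := exists_lift x
    rw [← mapFun_one (MvPolynomial.aeval id : MvPolynomial R O →ₐ[O] R), ← mapFun_mul]
    exact congrArg _ (ghost_ext (mvPolynomial_regular π) fun n => by
      simp only [ghost_mul, ghost_one]; ring)
  zero_mul x := by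
    obtain ⟨x, rfl⟩ := exists_lift x
    rw [← mapFun_zero (MvPolynomial.aeval id : MvPolynomial R O →ₐ[O] R), ← mapFun_mul]
    exact congrArg _ (ghost_ext (mvPolynomial_regular π) fun n => by
      simp only [ghost_mul, ghost_zero]; ring)
  mul_zero x := by
    obtain ⟨x, rfl⟩ := exists_lift x
    rw [← mapFun_zero (MvPolynomial.aeval id : MvPolynomial R O →ₐ[O] R), ← mapFun_mul]
    exact congrArg _ (ghost_ext (mvPolynomial_regular π) fun n => by
      simp only [ghost_mul, ghost_zero]; ring)
  left_distrib x y z := by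
    obtain ⟨x, rfl⟩ := exists_lift x; obtain ⟨y, rfl⟩ := exists_lift y
    obtain ⟨z, rfl⟩ := exists_lift z
    simp only [← mapFun_mul, ← mapFun_add]
    exact congrArg _ (ghost_ext (mvPolynomial_regular π) fun n => by
      simp only [ghost_mul, ghost_add]; ring)
  right_distrib x y z := by
    obtain ⟨x, rfl⟩ := exists_lift x; obtain ⟨y, rfl⟩ := exists_lift y
    obtain ⟨z, rfl⟩ := exists_lift z
    simp only [← mapFun_mul, ← mapFun_add]
    exact congrArg _ (ghost_ext (mvPolynomial_regular π) fun n => by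
      simp only [ghost_mul, ghost_add]; ring)
  nsmul := nsmulRec
  zsmul := zsmulRec

theorem regular_base (b : O) (h : algebraMap O O π * b = 0) : b = 0 :=
  IsUniformizer.regular (π := π) b h

instance : Algebra O (Witt π R) := RingHom.toAlgebra
  { toFun := const
    map_zero' := rfl
    map_one' := rfl
    map_add' := fun α β => by
      rw [const_eq_map (α + β), const_eq_map α, const_eq_map β, ← mapFun_add]
      exact congrArg _ (ghost_ext (regular_base (π := π)) fun n => by
        simp only [ghost_add, ghost_const, map_add])
    map_mul' := fun α β => by
      rw [const_eq_map (α * β), const_eq_map α, const_eq_map β, ← mapFun_mul]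
      exact congrArg _ (ghost_ext (regular_base (π := π)) fun n => by
        simp only [ghost_mul, ghost_const, map_mul]) }

/-- The ghost components as algebra maps. -/
def ghostHom (n : ℕ) : Witt π R →ₐ[O] R where
  toFun := ghost n
  map_zero' := ghost_zero n
  map_one' := ghost_one n
  map_add' := ghost_add n
  map_mul' := ghost_mul n
  commutes' := ghost_const n

/-- Functoriality of ramified Witt vectors. -/
def map {S : Type*} [CommRing S] [Algebra O S] (f : R →ₐ[O] S) : Witt π R →ₐ[O] Witt π S where
  toFun := mapFun f
  map_zero' := mapFun_zero f
  map_one' := mapFun_one f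
  map_add' := mapFun_add f
  map_mul' := mapFun_mul f
  commutes' := mapFun_const f

end Witt

end Witt

section Delta

variable {O : Type v} [CommRing O]

/-- A `δ_L`-structure on an `O`-algebra `A`. -/
class DeltaAlgebra (π : O) (A : Type u) [CommRing A] [Algebra O A] where
  δ : A → A
  δ_algebraMap : ∀ α : O,
    δ (algebraMap O A α) = algebraMap O A (divBy π (α - α ^ resCard π))
  δ_mul : ∀ x y : A, δ (x * y) =
    δ x * y ^ resCard π + x ^ resCard π * δ y + algebraMap O A π * δ x * δ y
  δ_add : ∀ x y : A, δ (x + y) = δ x + δ y - binomSum π x y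

/-- The `q`-Frobenius lift `φ(x) = x^q + π δ_L(x)`. -/
def frob (π : O) {A : Type u} [CommRing A] [Algebra O A] [DeltaAlgebra π A] (x : A) : A :=
  x ^ resCard π + algebraMap O A π * DeltaAlgebra.δ π x

theorem map_binomSum (π : O) {A B : Type*} [CommRing A] [Algebra O A] [CommRing B] [Algebra O B]
    (f : A →ₐ[O] B) (x y : A) : f (binomSum π x y) = binomSum π (f x) (f y) := by
  simp [binomSum, map_sum, map_mul, map_pow]

variable {π : O} [IsUniformizer π]

theorem Witt.delta_ext {P : Type*} [CommRing P] [Algebra O P]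
    (hreg : ∀ b : P, algebraMap O P π * b = 0 → b = 0) {x y : Witt π P}
    (h : ∀ n, algebraMap O P π * ghostHom n x = algebraMap O P π * ghostHom n y) : x = y :=
  ghost_ext hreg fun n => sub_eq_zero.1 (hreg _ (by rw [mul_sub]; exact sub_eq_zero.2 (h n)))

theorem Witt.ghostHom_delta {P : Type*} [CommRing P] [Algebra O P] (n : ℕ) (x : Witt π P) :
    algebraMap O P π * ghostHom n (delta x) = ghostHom (n + 1) x - ghostHom n x ^ resCard π :=
  ghost_delta n x

instance (R : Type u) [CommRing R] [Algebra O R] : DeltaAlgebra π (Witt π R) where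
  δ := Witt.delta
  δ_algebraMap α := by
    have h : ∀ β : O, algebraMap O (Witt π R) β =
        Witt.map (Algebra.ofId O R) (algebraMap O (Witt π O) β) := fun β =>
      (AlgHom.commutes _ β).symm
    rw [h, h, show Witt.delta (Witt.map (Algebra.ofId O R) (algebraMap O (Witt π O) α)) =
      Witt.map (Algebra.ofId O R) (Witt.delta (algebraMap O (Witt π O) α)) from
      (Witt.mapFun_delta _ _).symm]
    refine congrArg _ (Witt.delta_ext Witt.regular_base fun n => ?_)
    rw [Witt.ghostHom_delta]
    simp only [AlgHom.commutes]
    rw [← map_mul, mul_divBy (dvd_sub_pow_resCard π α)]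
    simp
  δ_mul x y := by
    obtain ⟨x, rfl⟩ := Witt.exists_lift x; obtain ⟨y, rfl⟩ := Witt.exists_lift y
    have h := fun z : Witt π (MvPolynomial R O) =>
      (Witt.mapFun_delta (MvPolynomial.aeval id : MvPolynomial R O →ₐ[O] R) z).symm
    change Witt.delta (Witt.map (MvPolynomial.aeval id) x * Witt.map (MvPolynomial.aeval id) y) =
      Witt.delta (Witt.map (MvPolynomial.aeval id) x) * _ +
      _ * Witt.delta (Witt.map (MvPolynomial.aeval id) y) +
      _ * Witt.delta (Witt.map (MvPolynomial.aeval id) x) *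
        Witt.delta (Witt.map (MvPolynomial.aeval id) y)
    have h : ∀ z, Witt.delta (Witt.map (MvPolynomial.aeval id : MvPolynomial R O →ₐ[O] R) z) =
      Witt.map (MvPolynomial.aeval id) (Witt.delta z : Witt π (MvPolynomial R O)) := h
    rw [← map_mul, h, h, h,
      ← AlgHom.commutes (Witt.map (MvPolynomial.aeval id : MvPolynomial R O →ₐ[O] R)) π]
    change _ = Witt.map (MvPolynomial.aeval id) _ * Witt.map (MvPolynomial.aeval id) _ ^ _ +
      Witt.map (MvPolynomial.aeval id) _ ^ _ * _ + _
    simp only [← map_pow, ← map_mul, ← map_add]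
    refine congrArg _ (Witt.delta_ext (mvPolynomial_regular π) fun n => ?_)
    have hx := Witt.ghostHom_delta n x
    have hy := Witt.ghostHom_delta n y
    rw [Witt.ghostHom_delta]
    simp only [map_mul, map_add, map_pow, AlgHom.commutes]
    rw [eq_add_of_sub_eq' hx.symm, eq_add_of_sub_eq' hy.symm]
    ring
  δ_add x y := by
    obtain ⟨x, rfl⟩ := Witt.exists_lift x; obtain ⟨y, rfl⟩ := Witt.exists_lift y
    have h : ∀ z, Witt.delta (Witt.map (MvPolynomial.aeval id : MvPolynomial R O →ₐ[O] R) z) =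
      Witt.map (MvPolynomial.aeval id) (Witt.delta z : Witt π (MvPolynomial R O)) := fun z =>
      (Witt.mapFun_delta (MvPolynomial.aeval id : MvPolynomial R O →ₐ[O] R) z).symm
    change Witt.delta (Witt.map (MvPolynomial.aeval id) x + Witt.map (MvPolynomial.aeval id) y) =
      Witt.delta (Witt.map (MvPolynomial.aeval id) x) +
      Witt.delta (Witt.map (MvPolynomial.aeval id) y) -
      binomSum π (Witt.map (MvPolynomial.aeval id) x) (Witt.map (MvPolynomial.aeval id) y)
    rw [← map_add, h, h, h, ← map_binomSum, ← map_add, ← map_sub]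
    refine congrArg _ (Witt.delta_ext (mvPolynomial_regular π) fun n => ?_)
    have hx := Witt.ghostHom_delta n x
    have hy := Witt.ghostHom_delta n y
    have hb := mul_binomSum π (Witt.ghostHom n x) (Witt.ghostHom n y)
    rw [Witt.ghostHom_delta]
    simp only [map_add, map_sub, map_binomSum, mul_add, mul_sub, hx, hy, hb]
    ring

end Delta

section Prism

variable {O : Type v} [CommRing O]

/-- The ideal `I` of `A` is an effective Cartier divisor on `Spec A`: Zariski-locally on `Spec A`
it is generated by a single nonzerodivisor. -/
def IsCartier {A : Type u} [CommRing A] (I : Ideal A) : Prop :=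
  ∃ s : Set A, Ideal.span s = ⊤ ∧ ∀ f ∈ s,
    ∃ d ∈ nonZeroDivisors (Localization.Away f),
      I.map (algebraMap A (Localization.Away f)) = Ideal.span {d}

/-- `A` is derived `J`-complete: for every `f ∈ J` the derived limit of
`⋯ → A → A → A` (all maps multiplication by `f`) vanishes. This derived limit is computed by
the two-term complex `∏ₙ A → ∏ₙ A`, `(xₙ) ↦ (xₙ - f xₙ₊₁)`. -/
def IsDerivedComplete {A : Type u} [CommRing A] (J : Ideal A) : Prop :=
  ∀ f ∈ J, Function.Bijective fun (x : ℕ → A) (n : ℕ) => x n - f * x (n + 1)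

/-- The pair `(A, I)` is an `L`-typical prism. -/
structure IsLPrism (π : O) {A : Type u} [CommRing A] [Algebra O A] [DeltaAlgebra π A]
    (I : Ideal A) : Prop where
  isCartier : IsCartier I
  isDerivedComplete : IsDerivedComplete (Ideal.span {algebraMap O A π} ⊔ I)
  uniformizer_mem : algebraMap O A π ∈ I ⊔ Ideal.span (frob π '' I)

/-- The `δ_L`-algebra `A` is perfect. -/
def IsPerfectDelta (π : O) (A : Type u) [CommRing A] [Algebra O A] [DeltaAlgebra π A] : Prop :=
  Function.Bijective (frob π : A → A)

/-- `L`-typical prisms. -/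
structure LPrism (π : O) : Type (max v (u + 1)) where
  carrier : Type u
  [commRing : CommRing carrier]
  [algebra : Algebra O carrier]
  [delta : DeltaAlgebra π carrier]
  ideal : Ideal carrier
  isPrism : IsLPrism π ideal

namespace LPrism

attribute [instance] commRing algebra delta

variable {π : O}

/-- Morphisms of `L`-typical prisms: maps of `δ_L`-algebras carrying the ideal into the ideal. -/
@[ext]
structure Hom (P Q : LPrism.{v, u} π) where
  toAlgHom : P.carrier →ₐ[O] Q.carrier
  map_δ : ∀ x, toAlgHom (DeltaAlgebra.δ π x) = DeltaAlgebra.δ π (toAlgHom x)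
  map_ideal : ∀ x ∈ P.ideal, toAlgHom x ∈ Q.ideal

instance : Category (LPrism.{v, u} π) where
  Hom := Hom
  id P := ⟨AlgHom.id O P.carrier, fun _ => rfl, fun _ h => h⟩
  comp f g := ⟨g.toAlgHom.comp f.toAlgHom,
    fun x => (congrArg g.toAlgHom (f.map_δ x)).trans (g.map_δ _),
    fun x hx => g.map_ideal _ (f.map_ideal x hx)⟩

/-- The map `A / I → B / J` induced by a morphism of prisms `(A, I) → (B, J)`. -/
def Hom.quot {P Q : LPrism.{v, u} π} (f : Hom P Q) :
    (P.carrier ⧸ P.ideal) →ₐ[O] (Q.carrier ⧸ Q.ideal) :=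
  Ideal.quotientMapₐ Q.ideal f.toAlgHom f.map_ideal

end LPrism

variable (π : O)

/-- The category of perfect `L`-typical prisms, a full subcategory of all `L`-typical prisms. -/
abbrev PerfectLPrism : Type (max v (u + 1)) :=
  ObjectProperty.FullSubcategory fun P : LPrism.{v, u} π => IsPerfectDelta π P.carrier

/-- An `O`-algebra is perfectoid if it is isomorphic to `A / I` for a perfect `L`-typical prism
`(A, I)`. -/
def IsPerfectoid (R : CommAlgCat.{u} O) : Prop :=
  ∃ P : PerfectLPrism.{v, u} π, Nonempty ((P.obj.carrier ⧸ P.obj.ideal) ≃ₐ[O] R)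

/-- The category of perfectoid `O`-algebras, a full subcategory of all `O`-algebras. -/
abbrev PerfectoidAlg : Type (max v (u + 1)) :=
  ObjectProperty.FullSubcategory fun R : CommAlgCat.{u} O => IsPerfectoid.{v, u} π R

/-- The functor `(A, I) ↦ A / I`. -/
def quotFunctor : PerfectLPrism.{v, u} π ⥤ PerfectoidAlg.{v, u} π where
  obj P := ⟨CommAlgCat.of O (P.obj.carrier ⧸ P.obj.ideal), P, ⟨AlgEquiv.refl⟩⟩
  map f := ObjectProperty.homMk (CommAlgCat.ofHom (LPrism.Hom.quot f.hom))
  map_id P := by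
    apply ObjectProperty.hom_ext
    apply CommAlgCat.hom_ext
    exact Ideal.Quotient.algHom_ext O rfl
  map_comp f g := by
    apply ObjectProperty.hom_ext
    apply CommAlgCat.hom_ext
    exact Ideal.Quotient.algHom_ext O rfl

end Prism

section Tilt

variable {O : Type v} [CommRing O] (π : O)

/-- The ideal `πR`. -/
abbrev piIdeal (R : Type u) [CommRing R] [Algebra O R] : Ideal R := Ideal.span {algebraMap O R π}

theorem mk_algebraMap_pi (R : Type u) [CommRing R] [Algebra O R] :
    algebraMap O (R ⧸ piIdeal π R) π = 0 :=
  Ideal.Quotient.eq_zero_iff_mem.2 (Ideal.subset_span rfl)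

theorem mk_eq_iff_dvd {R : Type u} [CommRing R] [Algebra O R] {a b : R} :
    Ideal.Quotient.mk (piIdeal π R) a = Ideal.Quotient.mk (piIdeal π R) b ↔
      algebraMap O R π ∣ a - b := by
  rw [Ideal.Quotient.eq, Ideal.mem_span_singleton]

/-- The limit of a sequence in the `I`-adic topology (`0` if there is none). -/
def adicLim {R : Type u} [CommRing R] (I : Ideal R) (f : ℕ → R) : R :=
  open Classical in
  if h : ∃ l : R, ∀ N : ℕ, ∀ᶠ n : ℕ in Filter.atTop, f n - l ∈ I ^ N then h.choose else 0

/-- The reduction map `R → R / π`. -/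
def modPi (R : Type u) [CommRing R] [Algebra O R] : R →ₐ[O] R ⧸ piIdeal π R :=
  Ideal.Quotient.mkₐ O (piIdeal π R)

/-- A chosen lift of an element of `R / π` to `R`. -/
def lift {R : Type u} [CommRing R] [Algebra O R] (x : R ⧸ piIdeal π R) : R :=
  (Ideal.Quotient.mk_surjective x).choose

theorem mk_lift {R : Type u} [CommRing R] [Algebra O R] (x : R ⧸ piIdeal π R) :
    Ideal.Quotient.mk (piIdeal π R) (lift π x) = x :=
  (Ideal.Quotient.mk_surjective x).choose_spec

theorem mem_piIdeal_pow {R : Type u} [CommRing R] [Algebra O R] {a : R} {n : ℕ} :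
    a ∈ piIdeal π R ^ n ↔ algebraMap O R π ^ n ∣ a := by
  rw [piIdeal, Ideal.span_singleton_pow, Ideal.mem_span_singleton]

variable {π} in
theorem piIdeal_le_comap {R S : Type u} [CommRing R] [Algebra O R] [CommRing S]
    [Algebra O S] (f : R →ₐ[O] S) : piIdeal π R ≤ (piIdeal π S).comap f := by
  rw [piIdeal, Ideal.span_le, Set.singleton_subset_iff]
  refine Ideal.mem_comap.2 ?_
  rw [AlgHom.commutes]
  exact Ideal.subset_span rfl

variable {π} in
theorem adicLim_spec {R : Type u} [CommRing R] [Algebra O R]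
    (hR : IsAdicComplete (piIdeal π R) R) {f : ℕ → R}
    (hf : ∀ n, algebraMap O R π ^ n ∣ f n - f (n + 1)) (n : ℕ) :
    algebraMap O R π ^ n ∣ f n - adicLim (piIdeal π R) f := by
  have hc : ∀ m k, algebraMap O R π ^ m ∣ f m - f (m + k) := by
    intro m k
    induction k with
    | zero => simp
    | succ k ih =>
      rw [← sub_add_sub_cancel _ (f (m + k)) _]
      exact dvd_add ih ((pow_dvd_pow _ (by omega)).trans (hf (m + k)))
  obtain ⟨l, hl⟩ := hR.toIsPrecomplete.prec (f := f) fun {m n} hmn => by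
    rw [SModEq.sub_mem, smul_eq_mul, Ideal.mul_top, mem_piIdeal_pow]
    obtain ⟨k, rfl⟩ := Nat.exists_eq_add_of_le hmn
    exact hc m k
  have hl' : ∀ n, algebraMap O R π ^ n ∣ f n - l := fun n => by
    have := hl n
    rwa [SModEq.sub_mem, smul_eq_mul, Ideal.mul_top, mem_piIdeal_pow] at this
  have h : ∃ l, ∀ N, ∀ᶠ n in Filter.atTop, f n - l ∈ piIdeal π R ^ N :=
    ⟨l, fun N => Filter.eventually_atTop.2 ⟨N, fun n hn =>
      (mem_piIdeal_pow π).2 ((pow_dvd_pow _ hn).trans (hl' n))⟩⟩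
  obtain ⟨m, hm⟩ := Filter.eventually_atTop.1 (h.choose_spec n)
  rw [adicLim, dif_pos h, ← sub_add_sub_cancel _ (f (n + m)) _]
  exact dvd_add (hc n m) ((mem_piIdeal_pow π).1 (hm _ (by omega)))

variable {π} in
theorem eq_of_forall_dvd {R : Type u} [CommRing R] [Algebra O R]
    (hR : IsAdicComplete (piIdeal π R) R) {a b : R}
    (h : ∀ n, algebraMap O R π ^ (n + 1) ∣ a - b) : a = b := by
  refine sub_eq_zero.1 (hR.toIsHausdorff.haus _ fun n => ?_)
  rw [SModEq.sub_mem, smul_eq_mul, Ideal.mul_top, mem_piIdeal_pow, sub_zero]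
  exact (pow_dvd_pow _ n.le_succ).trans (h n)

/-- The tilt `R♭`: sequences `(x₀, x₁, …)` in `R / π` with `xₙ₊₁ ^ q = xₙ`. -/
def Tilt [IsUniformizer π] (R : Type u) [CommRing R] [Algebra O R] :
    Subalgebra O (ℕ → R ⧸ piIdeal π R) where
  carrier := {x | ∀ n, x (n + 1) ^ resCard π = x n}
  mul_mem' hx hy n := by rw [Pi.mul_apply, mul_pow, hx n, hy n, Pi.mul_apply]
  add_mem' {x y} hx hy n := by
    have := mul_binomSum π (x (n + 1)) (y (n + 1))
    rw [mk_algebraMap_pi, zero_mul, hx n, hy n, sub_sub] at this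
    rw [Pi.add_apply, Pi.add_apply, sub_eq_zero.1 this.symm]
  algebraMap_mem' α n := by
    rw [Pi.algebraMap_apply, ← map_pow, ← sub_eq_zero, Pi.algebraMap_apply, ← map_sub]
    obtain ⟨c, hc⟩ := dvd_pow_resCard_sub π α
    rw [hc, map_mul, mk_algebraMap_pi, zero_mul]

variable [IsUniformizer π] {R : Type u} [CommRing R] [Algebra O R]

/-- The `n`-th coordinate `R♭ → R / π`. -/
def Tilt.coord (n : ℕ) : Tilt π R →ₐ[O] R ⧸ piIdeal π R :=
  (Pi.evalAlgHom O (fun _ : ℕ => R ⧸ piIdeal π R) n).comp (Tilt π R).val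

theorem Tilt.coord_pow (x : Tilt π R) (n m : ℕ) :
    coord π (n + m) x ^ resCard π ^ m = coord π n x := by
  induction m with
  | zero => simp
  | succ m ih =>
    rw [pow_succ', pow_mul, ← ih]
    exact congrArg (· ^ _) (x.2 (n + m))

variable {π} in
/-- The unique `qⁿ`-th root of an element of the tilt, obtained by shifting. -/
def Tilt.root (n : ℕ) (x : Tilt π R) : Tilt π R :=
  ⟨fun m => x.1 (m + n), fun m =>
    (congrArg (fun k => x.1 k ^ resCard π) (Nat.add_right_comm m 1 n)).trans (x.2 (m + n))⟩

theorem Tilt.root_pow (n : ℕ) (x : Tilt π R) : root n x ^ resCard π ^ n = x :=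
  Subtype.ext (funext fun m => coord_pow π x m n)

/-- Functoriality of the tilt. -/
def Tilt.map {S : Type u} [CommRing S] [Algebra O S] (f : R →ₐ[O] S) : Tilt π R →ₐ[O] Tilt π S :=
  AlgHom.codRestrict (AlgHom.pi fun n =>
    (Ideal.quotientMapₐ (piIdeal π S) f (piIdeal_le_comap f)).comp (coord π n)) (Tilt π S)
    fun x n => by
      simp only [AlgHom.pi_apply, AlgHom.comp_apply]
      rw [← map_pow]
      exact congrArg _ (x.2 n)

theorem Tilt.map_id : Tilt.map π (AlgHom.id O R) = AlgHom.id O (Tilt π R) := by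
  have h : Ideal.quotientMapₐ (piIdeal π R) (AlgHom.id O R) (piIdeal_le_comap _) =
      AlgHom.id O (R ⧸ piIdeal π R) := Ideal.Quotient.algHom_ext O rfl
  exact AlgHom.ext fun x => Subtype.ext (funext fun n => DFunLike.congr_fun h (x.1 n))

theorem Tilt.map_comp {S T : Type u} [CommRing S] [Algebra O S] [CommRing T] [Algebra O T]
    (f : R →ₐ[O] S) (g : S →ₐ[O] T) :
    Tilt.map π (g.comp f) = (Tilt.map π g).comp (Tilt.map π f) := by
  have h : Ideal.quotientMapₐ (piIdeal π T) (g.comp f) (piIdeal_le_comap _) =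
      (Ideal.quotientMapₐ (piIdeal π T) g (piIdeal_le_comap _)).comp
        (Ideal.quotientMapₐ (piIdeal π S) f (piIdeal_le_comap _)) :=
    Ideal.Quotient.algHom_ext O rfl
  exact AlgHom.ext fun x => Subtype.ext (funext fun n => DFunLike.congr_fun h (x.1 n))

/-- The sharp map `R♭ → R`, `x ↦ lim xₙ^(qⁿ)` for arbitrary lifts of the `xₙ ∈ R / π` to `R`. -/
def sharp (x : Tilt π R) : R :=
  adicLim (piIdeal π R) fun n => lift π (Tilt.coord π n x) ^ resCard π ^ n

variable (R) in
/-- `A_inf(R) = W_L(R♭)`. -/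
abbrev Ainf : Type u := Witt π (Tilt π R)

/-- The underlying function of `θ : A_inf(R) → R`,
`(x₀, x₁, …) ↦ ∑ₙ (xₙ^(1/qⁿ))♯ πⁿ`. -/
def thetaFun (x : Ainf π R) : R :=
  adicLim (piIdeal π R) fun n =>
    ∑ i ∈ Finset.range n, sharp π (Tilt.root i (x.coeff i)) * algebraMap O R π ^ i

variable {π}

theorem sharp_spec (hR : IsAdicComplete (piIdeal π R) R) (x : Tilt π R) (n : ℕ) :
    algebraMap O R π ^ (n + 1) ∣ lift π (Tilt.coord π n x) ^ resCard π ^ n - sharp π x := by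
  have h : ∀ n, algebraMap O R π ^ (n + 1) ∣ lift π (Tilt.coord π n x) ^ resCard π ^ n -
      lift π (Tilt.coord π (n + 1) x) ^ resCard π ^ (n + 1) := by
    intro n
    rw [pow_succ' (resCard π), pow_mul]
    refine dvd_pow_pow_sub_pow_pow π ((mk_eq_iff_dvd π).1 ?_) n
    rw [map_pow, mk_lift, mk_lift]
    exact (x.2 n).symm
  rw [← sub_add_sub_cancel _ (lift π (Tilt.coord π (n + 1) x) ^ resCard π ^ (n + 1)) _]
  exact dvd_add (h n)
    (adicLim_spec hR (fun n => (pow_dvd_pow _ n.le_succ).trans (h n)) (n + 1))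

/-- Modulo `πⁿ⁺¹`, the map `θ` is a ghost component of a lift. -/
theorem thetaFun_spec (hR : IsAdicComplete (piIdeal π R) R) (x : Ainf π R) (n : ℕ)
    (y : Witt π R)
    (hy : Witt.map (π := π) (modPi π R) y = Witt.map (Tilt.coord π n) x) :
    algebraMap O R π ^ (n + 1) ∣ Witt.ghostHom n y - thetaFun π x := by
  have h1 := adicLim_spec hR (f := fun n => ∑ i ∈ Finset.range n,
    sharp π (Tilt.root i (x.coeff i)) * algebraMap O R π ^ i) (fun n => by
      rw [Finset.sum_range_succ, sub_add_cancel_left, dvd_neg]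
      exact dvd_mul_left _ _) (n + 1)
  refine (dvd_add ?_ h1).trans (dvd_of_eq (sub_add_sub_cancel _ _ _))
  change _ ∣ ghostSeq π n y.coeff - _
  rw [← sub_add_sub_cancel _ (ghostSeq π n fun i => lift π (Tilt.coord π n (x.coeff i))) _]
  refine dvd_add (ghostSeq_congr π n fun i => (mk_eq_iff_dvd π).1 ?_) ?_
  · rw [mk_lift]
    exact congrFun (congrArg Witt.coeff hy) i
  · rw [ghostSeq, ← Finset.sum_sub_distrib]
    refine Finset.dvd_sum fun i hi => ?_
    rw [Finset.mem_range] at hi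
    have h2 := sharp_spec hR (Tilt.root i (x.coeff i)) (n - i)
    have h3 : Tilt.coord π (n - i) (Tilt.root i (x.coeff i)) = Tilt.coord π n (x.coeff i) :=
      congrArg (x.coeff i).1 (show n - i + i = n by omega)
    rw [h3] at h2
    have h4 := mul_dvd_mul_left (algebraMap O R π ^ i) h2
    rw [← pow_add, show i + (n - i + 1) = n + 1 by omega] at h4
    rwa [mul_comm (sharp π _), ← mul_sub]

theorem exists_level_lift (x : Ainf π R) (n : ℕ) : ∃ y : Witt π R,
    Witt.map (π := π) (modPi π R) y = Witt.map (Tilt.coord π n) x :=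
  ⟨⟨fun i => lift π (Tilt.coord π n (x.coeff i))⟩, Witt.ext (funext fun _ => mk_lift π _)⟩

/-- The map `θ : A_inf(R) → R`, for `R` a `π`-adically complete `O`-algebra. -/
def theta (hR : IsAdicComplete (piIdeal π R) R) : Ainf π R →ₐ[O] R :=
  have hc : ∀ α : O, thetaFun π (algebraMap O (Ainf π R) α) = algebraMap O R α := fun α =>
    (eq_of_forall_dvd hR fun n => by
      have := thetaFun_spec hR (algebraMap O (Ainf π R) α) n (algebraMap O (Witt π R) α)
        (by rw [AlgHom.commutes, AlgHom.commutes])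
      rwa [AlgHom.commutes] at this).symm
  { toFun := thetaFun π
    map_zero' := by simpa using hc 0
    map_one' := by simpa using hc 1
    commutes' := hc
    map_add' := fun x y => eq_of_forall_dvd hR fun n => by
      obtain ⟨a, ha⟩ := exists_level_lift x n
      obtain ⟨b, hb⟩ := exists_level_lift y n
      have h := thetaFun_spec hR (x + y) n (a + b) (by rw [map_add, map_add, ha, hb])
      have h1 := thetaFun_spec hR x n a ha
      have h2 := thetaFun_spec hR y n b hb
      rw [map_add] at h
      refine (dvd_sub (dvd_add h1 h2) h).trans (dvd_of_eq ?_)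
      ring
    map_mul' := fun x y => eq_of_forall_dvd hR fun n => by
      obtain ⟨a, ha⟩ := exists_level_lift x n
      obtain ⟨b, hb⟩ := exists_level_lift y n
      have h := thetaFun_spec hR (x * y) n (a * b) (by rw [map_mul, map_mul, ha, hb])
      have h1 := thetaFun_spec hR x n a ha
      have h2 := thetaFun_spec hR y n b hb
      rw [map_mul] at h
      refine (dvd_sub (dvd_add (h1.mul_right (Witt.ghostHom n b))
        (h2.mul_left (thetaFun π x))) h).trans (dvd_of_eq ?_)
      ring }

variable (π) in
/-- Functoriality of `A_inf`. -/
def Ainf.map {S : Type u} [CommRing S] [Algebra O S] (f : R →ₐ[O] S) : Ainf π R →ₐ[O] Ainf π S :=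
  Witt.map (Tilt.map π f)

theorem Ainf.map_id : Ainf.map π (AlgHom.id O R) = AlgHom.id O (Ainf π R) :=
  AlgHom.ext fun x => Witt.ext (funext fun n =>
    DFunLike.congr_fun (Tilt.map_id π (R := R)) (x.coeff n))

theorem Ainf.map_comp {S T : Type u} [CommRing S] [Algebra O S] [CommRing T] [Algebra O T]
    (f : R →ₐ[O] S) (g : S →ₐ[O] T) :
    (Ainf.map π (g.comp f) : Ainf π R →ₐ[O] Ainf π T) = (Ainf.map π g).comp (Ainf.map π f) :=
  AlgHom.ext fun x => Witt.ext (funext fun n =>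
    DFunLike.congr_fun (Tilt.map_comp π f g) (x.coeff n))

theorem theta_map {S : Type u} [CommRing S] [Algebra O S] (hR : IsAdicComplete (piIdeal π R) R)
    (hS : IsAdicComplete (piIdeal π S) S) (f : R →ₐ[O] S) (x : Ainf π R) :
    theta hS (Ainf.map π f x) = f (theta hR x) := by
  refine eq_of_forall_dvd hS fun n => ?_
  obtain ⟨a, ha⟩ := exists_level_lift x n
  have h1 := thetaFun_spec hR x n a ha
  have h2 := thetaFun_spec hS (Ainf.map π f x) n (Witt.map f a) (Witt.ext (funext fun i => by
    have := congrFun (congrArg Witt.coeff ha) i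
    exact congrArg (Ideal.quotientMapₐ (piIdeal π S) f (piIdeal_le_comap f)) this))
  have h3 := map_dvd f h1
  rw [map_pow, AlgHom.commutes, map_sub] at h3
  have h4 : f (Witt.ghostHom n a) = Witt.ghostHom n (Witt.map f a) := (ghostSeq_map π f n _).symm
  rw [h4] at h3
  refine (dvd_sub h3 h2).trans (dvd_of_eq ?_)
  change _ - f (thetaFun π x) - (_ - thetaFun π (Ainf.map π f x)) =
    thetaFun π (Ainf.map π f x) - f (thetaFun π x)
  ring

end Tilt

section Inverse

variable {O : Type v} [CommRing O] {π : O} [IsUniformizer π]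

/-- The functor `R ↦ (A_inf(R), ker θ)`, given that perfectoid algebras are `π`-adically complete
and that `(A_inf(R), ker θ)` is a perfect prism for each perfectoid `R`. -/
def ainfFunctor
    (hc : ∀ R : PerfectoidAlg.{v, u} π, IsAdicComplete (piIdeal π R.obj) R.obj)
    (hp : ∀ R : PerfectoidAlg.{v, u} π,
      IsLPrism π (RingHom.ker (theta (hc R))) ∧ IsPerfectDelta π (Ainf π R.obj)) :
    PerfectoidAlg.{v, u} π ⥤ PerfectLPrism.{v, u} π where
  obj R :=
    { obj :=
        { carrier := Ainf π R.obj
          ideal := RingHom.ker (theta (hc R))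
          isPrism := (hp R).1 }
      property := (hp R).2 }
  map {R S} f := ObjectProperty.homMk
    { toAlgHom := Ainf.map π f.hom.hom
      map_δ := Witt.mapFun_delta _
      map_ideal := fun x hx => by
        rw [RingHom.mem_ker] at hx ⊢
        rw [theta_map (hc R) (hc S), hx, map_zero] }
  map_id R := ObjectProperty.hom_ext _ (LPrism.Hom.ext (Ainf.map_id (π := π)))
  map_comp f g := ObjectProperty.hom_ext _ (LPrism.Hom.ext (Ainf.map_comp f.hom.hom g.hom.hom))

end Inverse

section LocalField

/-- The ring of integers `O_L` of a finite extension `L` of `ℚ_p`. -/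
abbrev RingOfIntegers (p : ℕ) [Fact p.Prime] (L : Type v) [Field L] [Algebra ℤ_[p] L] : Type v :=
  integralClosure ℤ_[p] L

instance (p : ℕ) [Fact p.Prime] (L : Type v) [Field L] [Algebra ℚ_[p] L]
    [FiniteDimensional ℚ_[p] L] [Algebra ℤ_[p] L] [IsScalarTower ℤ_[p] ℚ_[p] L]
    (π : RingOfIntegers p L) [hπ : Fact (Ideal.span {π}).IsMaximal] : IsUniformizer π := by
  have hmax := hπ.out
  have : (Ideal.comap (algebraMap ℤ_[p] (RingOfIntegers p L)) (Ideal.span {π})).IsMaximal :=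
    Ideal.isMaximal_comap_of_isIntegral_of_isMaximal _
  have hcomap := IsLocalRing.eq_maximalIdeal this
  refine ⟨fun a h => ?_, hmax, ?_⟩
  · refine (mul_eq_zero.1 h).resolve_left ?_
    rintro rfl
    have hp : (p : ℤ_[p]) ∈ IsLocalRing.maximalIdeal ℤ_[p] := by
      rw [PadicInt.maximalIdeal_eq_span_p]; exact Ideal.subset_span rfl
    rw [← hcomap, Ideal.mem_comap, Ideal.mem_span_singleton, zero_dvd_iff, map_natCast] at hp
    have h2 := congrArg (algebraMap (RingOfIntegers p L) L) hp
    rw [map_natCast, map_zero, ← map_natCast (algebraMap ℚ_[p] L), map_eq_zero] at h2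
    exact (Fact.out : p.Prime).ne_zero (by exact_mod_cast h2)
  · have : Module.Finite ℤ_[p] (RingOfIntegers p L) :=
      IsIntegralClosure.finite ℤ_[p] ℚ_[p] L (RingOfIntegers p L)
    have hfin : Finite (ℤ_[p] ⧸ Ideal.comap (algebraMap ℤ_[p] (RingOfIntegers p L))
        (Ideal.span {π})) := by
      rw [hcomap]
      exact Finite.of_equiv (ZMod p) (PadicInt.residueField (p := p)).symm.toEquiv
    have : Module.Finite (ℤ_[p] ⧸ Ideal.comap (algebraMap ℤ_[p] (RingOfIntegers p L))
        (Ideal.span {π})) (RingOfIntegers p L ⧸ Ideal.span {π}) :=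
      Module.Finite.of_restrictScalars_finite ℤ_[p] _ _
    exact Module.finite_of_finite (ℤ_[p] ⧸ Ideal.comap (algebraMap ℤ_[p] (RingOfIntegers p L))
        (Ideal.span {π}))

end LocalField

end

end LTypical

/-! The key fact is that a perfect prism (A, I) is determined by R = A / I, through A / π ≅ R♭ and A
≅ W_L(A / π).

The ideal I is principal. Perfectness makes A π-torsion-free, since φ kills π-torsion. Applying δ to
a relation expressing π ∈ I + φ(I)A, and then to a sharper one in I² + φ(I)A, produces b ∈ I with
δ(b) a unit (`IsLPrism.exists_distinguished`). A local computation with δ shows that such a b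
generates I (`IsLPrism.eq_span_of_distinguished`), and the Cartier condition makes it a
nonzerodivisor.

The quotient R is π-adically complete. It is derived π-complete as the quotient of A by one element,
and its π-power torsion is killed by π (`pi_mul_eq_zero_of_pow`). For derived complete rings,
bounded torsion gives ordinary completeness.

The reduction A / π is the tilt of R. It is a perfect ring on which φ is x ↦ x^q. It is derived
b-complete, and being reduced it has bounded b-torsion, hence it is b-adically complete. The map x ↦
(φ⁻ⁿ(x) mod (π, I))ₙ identifies it with R♭, because divisibility of φ⁻ⁿ(x) by b corresponds to
divisibility of x by b^(qⁿ) modulo π (`toTilt_eq_zero_iff`, `toTilt_surjective`).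

Finally A ≅ W_L(A / π) (`map_wittSection_bijective`). The vector with ghost components x, φ(x),
φ²(x), … gives a δ-map A → W_L(A). Composed with reduction it is bijective by successive
approximation modulo π, because over a perfect ring with π = 0 multiplication by π sends (x₀, x₁, …)
to (0, x₀^q, x₁^q, …).

The resulting isomorphism A ≅ A_inf(A / I) carries the projection A → A / I to θ (`theta_toAinf`).
Every perfectoid R is some A / I, so transport along it shows that (A_inf(R), ker θ) is a perfect
prism. Naturality of this isomorphism and of θ gives the unit and counit of the equivalence. -/

namespace LTypical

/-! ### Derived completeness along one element. -/

section DerivedComplete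

variable {B : Type*} [CommRing B] {f : B}

theorem eq_zero_of_forall_eq_mul_succ
    (h : Function.Injective fun (x : ℕ → B) (n : ℕ) => x n - f * x (n + 1)) {x : ℕ → B}
    (hx : ∀ n, x n = f * x (n + 1)) : x = 0 :=
  h (by funext n; simp [← hx n])

/-- The preimage of the constant sequence 1 is shift-invariant by injectivity, hence a constant x₀
with (1 - f) x₀ = 1; it plays the role of the geometric series. -/
theorem isUnit_one_sub_of_bijective
    (h : Function.Bijective fun (x : ℕ → B) (n : ℕ) => x n - f * x (n + 1)) :
    IsUnit (1 - f) := by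
  obtain ⟨x, hx⟩ := h.2 fun _ => 1
  have e : (fun n => x (n + 1)) = x := h.1 (by
    rw [hx]; funext n; exact congrFun hx (n + 1))
  have h0 : x 0 - f * x 1 = 1 := congrFun hx 0
  rw [show x 1 = x 0 from congrFun e 0] at h0
  exact IsUnit.of_mul_eq_one (x 0) (by rw [sub_mul, one_mul, h0])

theorem IsDerivedComplete.le_jacobson {B : Type u} [CommRing B] {J : Ideal B}
    (h : IsDerivedComplete J) : J ≤ Ring.jacobson B := by
  intro x hx
  rw [← Ideal.jacobson_bot, Ideal.mem_jacobson_bot]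
  intro y
  have := isUnit_one_sub_of_bijective (h (-(x * y)) (neg_mem (J.mul_mem_right y hx)))
  rwa [sub_neg_eq_add, add_comm] at this

/-- If x = fⁿ yₙ for all n, the yₙ need not be compatible, but bounded torsion makes the f yₙ
compatible, and injectivity kills compatible f-divisible sequences. -/
theorem eq_zero_of_forall_pow_dvd
    (h : Function.Injective fun (x : ℕ → B) (n : ℕ) => x n - f * x (n + 1))
    (ht : ∀ (n : ℕ) (x : B), f ^ n * x = 0 → f * x = 0) {x : B} (hx : ∀ n, f ^ n ∣ x) :
    x = 0 := by
  choose y hy using hx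
  have h1 : ∀ n, f * y n = f * (f * y (n + 1)) := fun n => by
    have : f ^ n * (y n - f * y (n + 1)) = 0 := by
      rw [mul_sub, ← hy n, ← mul_assoc, ← pow_succ, ← hy (n + 1), sub_self]
    have := ht n _ this
    rwa [mul_sub, sub_eq_zero] at this
  have := congrFun (eq_zero_of_forall_eq_mul_succ h (x := fun n => f * y (n + 1))
    fun n => h1 (n + 1)) 0
  have h2 := hy 1
  rw [pow_one] at h2
  exact h2.trans this

/-- Writing the increments as fⁿ cₙ and solving wₙ - f wₙ₊₁ = cₙ makes w₀ a substitute for the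
series ∑ fⁿ cₙ. The limit need not be unique here. -/
theorem exists_forall_sub_dvd
    (h : Function.Surjective fun (x : ℕ → B) (n : ℕ) => x n - f * x (n + 1)) {z : ℕ → B}
    (hz : ∀ n, f ^ n ∣ z (n + 1) - z n) : ∃ l, ∀ n, f ^ n ∣ z n - l := by
  choose c hc using hz
  obtain ⟨w, hw⟩ := h c
  have hw' : ∀ n, w n - f * w (n + 1) = c n := congrFun hw
  have e : ∀ n, z n - (z 0 + w 0) = f ^ n * (- w n) := by
    intro n
    induction n with
    | zero => ring
    | succ n ih =>
      have := hc n
      rw [← hw' n] at this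
      linear_combination this + ih
  exact ⟨z 0 + w 0, fun n => ⟨_, e n⟩⟩

theorem isAdicComplete_span_singleton
    (h : Function.Bijective fun (x : ℕ → B) (n : ℕ) => x n - f * x (n + 1))
    (ht : ∀ (n : ℕ) (x : B), f ^ n * x = 0 → f * x = 0) :
    IsAdicComplete (Ideal.span {f}) B where
  haus' x hx := eq_zero_of_forall_pow_dvd h.1 ht fun n => by
    have := hx n
    rwa [SModEq.zero, smul_eq_mul, Ideal.mul_top, Ideal.span_singleton_pow,
      Ideal.mem_span_singleton] at this
  prec' z hz := by
    obtain ⟨l, hl⟩ := exists_forall_sub_dvd h.2 (z := z) fun n => by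
      have := (hz n.le_succ).symm
      rwa [SModEq.sub_mem, smul_eq_mul, Ideal.mul_top, Ideal.span_singleton_pow,
        Ideal.mem_span_singleton] at this
    refine ⟨l, fun n => ?_⟩
    rw [SModEq.sub_mem, smul_eq_mul, Ideal.mul_top, Ideal.span_singleton_pow,
      Ideal.mem_span_singleton]
    exact hl n

/-- Derived complete modules are stable under cokernels, here of multiplication by g. For
injectivity, a lifted solution a satisfies the equation up to g c; solving the same equation for c
by w makes a - g w an exact solution, hence 0. -/
theorem bijective_quotient_span_singleton {g : B}
    (h : Function.Bijective fun (x : ℕ → B) (n : ℕ) => x n - f * x (n + 1)) :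
    Function.Bijective fun (x : ℕ → B ⧸ Ideal.span {g}) (n : ℕ) =>
      x n - Ideal.Quotient.mk (Ideal.span {g}) f * x (n + 1) := by
  constructor
  · intro x y hxy
    choose a ha using fun n => Ideal.Quotient.mk_surjective (x n - y n)
    have hd : ∀ n, g ∣ a n - f * a (n + 1) := fun n => by
      rw [← Ideal.mem_span_singleton, ← Ideal.Quotient.eq_zero_iff_mem, map_sub, map_mul, ha, ha]
      have : x n - _ * x (n + 1) = y n - _ * y (n + 1) := congrFun hxy n
      linear_combination this
    choose c hc using hd
    obtain ⟨w, hw⟩ := h.2 c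
    have hw' : ∀ n, w n - f * w (n + 1) = c n := congrFun hw
    have := eq_zero_of_forall_eq_mul_succ h.1 (x := fun n => a n - g * w n) fun n => by
      have := hc n
      rw [← hw' n] at this
      linear_combination this
    funext n
    rw [← sub_eq_zero, ← ha, Ideal.Quotient.eq_zero_iff_mem, Ideal.mem_span_singleton]
    exact ⟨w n, sub_eq_zero.1 (congrFun this n)⟩
  · intro c
    choose a ha using fun n => Ideal.Quotient.mk_surjective (c n)
    obtain ⟨w, hw⟩ := h.2 a
    refine ⟨fun n => Ideal.Quotient.mk _ (w n), funext fun n => ?_⟩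
    rw [← ha n, ← hw]
    simp

end DerivedComplete

/-! ### Frobenius lifts and π-torsion. -/

section Base

variable {O : Type v} [CommRing O] {π : O} {A : Type u} [CommRing A] [Algebra O A]

theorem binomSum_mem {J : Ideal A} {x : A} (hx : x ∈ J) (y : A) : binomSum π x y ∈ J := by
  refine sum_mem fun i hi => ?_
  rw [Finset.mem_Ioo] at hi
  exact J.mul_mem_right _ (J.mul_mem_left _ (J.pow_mem_of_mem hx _ hi.1))

theorem pow_regular (hA : ∀ x : A, algebraMap O A π * x = 0 → x = 0) (n : ℕ) {x : A}
    (hx : algebraMap O A π ^ n * x = 0) : x = 0 := by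
  induction n with
  | zero => simpa using hx
  | succ n ih => exact ih (hA _ (by rw [← hx]; ring))

end Base

section Frobenius

variable {O : Type v} [CommRing O] {π : O} [IsUniformizer π] {A : Type u} [CommRing A]
  [Algebra O A] [DeltaAlgebra π A]

open DeltaAlgebra

theorem frob_algebraMap (α : O) : frob π (algebraMap O A α) = algebraMap O A α := by
  rw [frob, δ_algebraMap, ← map_mul, mul_divBy (dvd_sub_pow_resCard π α), map_sub, map_pow]
  ring

variable (π A) in
/-- The Frobenius lift as an algebra map. -/
noncomputable def frobHom : A →ₐ[O] A where
  toFun := frob π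
  map_zero' := by simpa using frob_algebraMap (π := π) (A := A) 0
  map_one' := by simpa using frob_algebraMap (π := π) (A := A) 1
  map_add' x y := by
    rw [frob, frob, frob, δ_add]
    linear_combination -mul_binomSum π x y
  map_mul' x y := by
    rw [frob, frob, frob, δ_mul]
    ring
  commutes' := frob_algebraMap

theorem frobHom_apply (x : A) :
    frobHom π A x = x ^ resCard π + algebraMap O A π * δ π x := rfl

theorem dvd_frobHom_sub (x : A) : algebraMap O A π ∣ frobHom π A x - x ^ resCard π :=
  ⟨δ π x, by rw [frobHom_apply, add_sub_cancel_left]⟩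

theorem delta_mul (x y : A) : δ π (x * y) = δ π x * frobHom π A y + x ^ resCard π * δ π y := by
  rw [δ_mul, frobHom_apply]; ring

theorem delta_zero : δ π (0 : A) = 0 := by
  have := δ_algebraMap (π := π) (A := A) 0
  rw [map_zero] at this
  rw [this, zero_pow (by have := two_le_resCard π; omega), sub_zero]
  -- `divBy` is a choice of quotient; regularity of π pins it down.
  have : divBy π (0 : O) = 0 := IsUniformizer.regular (π := π) _ (mul_divBy (dvd_zero π))
  rw [this, map_zero]

theorem delta_uniformizer :
    δ π (algebraMap O A π) = 1 - algebraMap O A π ^ (resCard π - 1) := by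
  rw [δ_algebraMap]
  have h2 := two_le_resCard π
  have : divBy π (π - π ^ resCard π) = 1 - π ^ (resCard π - 1) := by
    refine sub_eq_zero.1 (IsUniformizer.regular (π := π) _ ?_)
    rw [mul_sub, mul_divBy (dvd_sub_pow_resCard π π), mul_sub, ← pow_succ',
      Nat.sub_add_cancel (by omega)]
    ring
  rw [this]
  simp

/-- If π x = 0 then 0 = δ(π x) = (1 - π^(q-1)) φ(x) + π^q δ(x). Since π^q δ(x) = π^(q-1) (φ(x) -
x^q) and π^(q-1) x^q = 0, this says φ(x) = 0. -/
theorem regular_of_injective (hA : Function.Injective (frob π : A → A)) {x : A}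
    (hx : algebraMap O A π * x = 0) : x = 0 := by
  have h2 := two_le_resCard π
  obtain ⟨m, hm⟩ : ∃ m, resCard π = m + 2 := ⟨resCard π - 2, by omega⟩
  have h1 := delta_mul (π := π) (algebraMap O A π) x
  rw [hx, delta_zero, delta_uniformizer, hm, show m + 2 - 1 = m + 1 by omega] at h1
  have h3 := frobHom_apply (π := π) x
  rw [hm] at h3
  refine hA (?_ : frobHom π A x = frobHom π A 0)
  rw [map_zero]
  linear_combination -h1 + algebraMap O A π ^ (m + 1) * h3 +
    algebraMap O A π ^ m * x ^ (m + 1) * hx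

theorem delta_frobHom (hA : ∀ x : A, algebraMap O A π * x = 0 → x = 0) (x : A) :
    δ π (frobHom π A x) = frobHom π A (δ π x) := by
  refine sub_eq_zero.1 (hA _ ?_)
  have h1 := frobHom_apply (π := π) (frobHom π A x)
  have h2 := congrArg (frobHom π A) (frobHom_apply (π := π) x)
  rw [map_add, map_mul, map_pow, AlgHom.commutes] at h2
  linear_combination h2 - h1

end Frobenius

/-! ### The ideal of a perfect prism has a distinguished generator. -/

section Principal

variable {O : Type v} [CommRing O] {π : O} [IsUniformizer π] {A : Type u} [CommRing A]
  [Algebra O A] [DeltaAlgebra π A] {I : Ideal A}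

open DeltaAlgebra

theorem frobHom_mem {x : A} (hx : x ∈ Ideal.span {algebraMap O A π} ⊔ I) :
    frobHom π A x ∈ Ideal.span {algebraMap O A π} ⊔ I := by
  rw [frobHom_apply]
  refine add_mem (Ideal.pow_mem_of_mem _ hx _ (by have := two_le_resCard π; omega)) ?_
  exact Ideal.mul_mem_right _ _ (Ideal.mem_sup_left (Ideal.mem_span_singleton_self _))

theorem delta_mem_of_mem_sq {x : A} (hx : x ∈ I ^ 2) :
    δ π x ∈ Ideal.span {algebraMap O A π} ⊔ I := by
  rw [pow_two] at hx
  induction hx using Submodule.mul_induction_on' with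
  | mem_mul_mem a ha b hb =>
    rw [delta_mul]
    refine add_mem (Ideal.mul_mem_left _ _ (frobHom_mem (Ideal.mem_sup_right hb)))
      (Ideal.mul_mem_right _ _ (Ideal.mem_sup_right
        (Ideal.pow_mem_of_mem _ ha _ (by have := two_le_resCard π; omega))))
  | add a ha b hb h1 h2 =>
    rw [δ_add]
    exact sub_mem (add_mem h1 h2) (binomSum_mem (Ideal.mem_sup_right (Ideal.mul_le_left ha)) _)

/-- Applying `δ` to an expression `π = a + φ(b)`. -/
theorem one_sub_delta_add_pow_mem (hA : ∀ x : A, algebraMap O A π * x = 0 → x = 0) {a b : A}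
    (ha : a ∈ I) (h : algebraMap O A π = a + frobHom π A b) :
    1 - (δ π a + δ π b ^ resCard π) ∈ Ideal.span {algebraMap O A π} ⊔ I := by
  have h1 := delta_uniformizer (π := π) (A := A)
  nth_rw 1 [h] at h1
  -- Now 1 - π^(q-1) = δ(a) + φ(δ(b)) - `binomSum π a (φ b)`, where φ(δ(b)) ≡ δ(b)^q modulo π and
  -- the binomial term lies in I because a does.
  rw [δ_add, delta_frobHom hA, frobHom_apply] at h1
  have e : 1 - (δ π a + δ π b ^ resCard π) = algebraMap O A π ^ (resCard π - 1) +
      algebraMap O A π * δ π (δ π b) - binomSum π a (frobHom π A b) := by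
    linear_combination -h1
  have hπ : algebraMap O A π ∈ Ideal.span {algebraMap O A π} ⊔ I :=
    Ideal.mem_sup_left (Ideal.mem_span_singleton_self _)
  rw [e]
  exact sub_mem (add_mem (Ideal.pow_mem_of_mem _ hπ _ (by have := two_le_resCard π; omega))
    (Ideal.mul_mem_right _ _ hπ)) (Ideal.mem_sup_right (binomSum_mem ha _))

theorem span_frob_image (hA : IsPerfectDelta π A) {x : A} (hx : x ∈ Ideal.span (frob π '' I)) :
    ∃ b ∈ I, frobHom π A b = x := by
  have : Ideal.span (frob π '' I) = I.map (frobHom π A) := rfl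
  rw [this, Ideal.mem_map_iff_of_surjective _ hA.2] at hx
  exact hx

/-- The same δ-computation is used twice. With a ∈ I it only shows that δ(I) generates the unit
ideal. This improves the relation to one with a ∈ I², where δ(a) ∈ (π, I) no longer contributes, so
δ(b)^q itself is a unit. -/
theorem IsLPrism.exists_distinguished (hI : IsLPrism π I) (hA : IsPerfectDelta π A) :
    ∃ b ∈ I, IsUnit (δ π b) := by
  have hreg : ∀ x : A, algebraMap O A π * x = 0 → x = 0 := fun _ => regular_of_injective hA.1
  have hjac := hI.isDerivedComplete.le_jacobson
  have hunit : ∀ x : A, 1 - x ∈ Ideal.span {algebraMap O A π} ⊔ I → IsUnit x := fun x hx => by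
    have := isUnit_one_sub_of_bijective (hI.isDerivedComplete _ hx)
    rwa [sub_sub_cancel] at this
  have htop : Ideal.span (δ π '' (I : Set A)) = ⊤ := by
    obtain ⟨a, ha, c, hc, h⟩ := Submodule.mem_sup.1 hI.uniformizer_mem
    obtain ⟨b, hb, rfl⟩ := span_frob_image hA hc
    have h1 := hunit _ (one_sub_delta_add_pow_mem hreg ha h.symm)
    refine Ideal.eq_top_of_isUnit_mem _ (add_mem ?_ ?_) h1
    · exact Ideal.subset_span (Set.mem_image_of_mem _ ha)
    · exact Ideal.pow_mem_of_mem _ (Ideal.subset_span (Set.mem_image_of_mem _ hb)) _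
        (by have := two_le_resCard π; omega)
  -- For x ∈ I, π δ(x) = φ(x) - x^q lies in I² + φ(I)A because q ≥ 2. As the δ(x) generate A, so
  -- does π.
  have hsq : algebraMap O A π ∈ I ^ 2 ⊔ Ideal.span (frob π '' I) := by
    have : Ideal.span (δ π '' (I : Set A)) ≤
        (I ^ 2 ⊔ Ideal.span (frob π '' I)).colon {algebraMap O A π} := by
      rw [Ideal.span_le]
      rintro _ ⟨x, hx, rfl⟩
      rw [SetLike.mem_coe, Submodule.mem_colon_singleton, smul_eq_mul]
      have : δ π x * algebraMap O A π = frobHom π A x - x ^ resCard π := by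
        rw [frobHom_apply]; ring
      rw [this]
      exact sub_mem (Ideal.mem_sup_right (Ideal.subset_span ⟨x, hx, rfl⟩))
        (Ideal.mem_sup_left (Ideal.pow_le_pow_right (two_le_resCard π) (Ideal.pow_mem_pow hx _)))
    have := this (htop ▸ Submodule.mem_top : (1 : A) ∈ _)
    rwa [Submodule.mem_colon_singleton, one_smul] at this
  obtain ⟨a, ha, c, hc, h⟩ := Submodule.mem_sup.1 hsq
  obtain ⟨b, hb, rfl⟩ := span_frob_image hA hc
  refine ⟨b, hb, ?_⟩
  have h1 := one_sub_delta_add_pow_mem hreg (Ideal.pow_le_self two_ne_zero ha) h.symm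
  have h2 := add_mem h1 (delta_mem_of_mem_sq (π := π) ha)
  rw [show 1 - (δ π a + δ π b ^ resCard π) + δ π a = 1 - δ π b ^ resCard π by ring] at h2
  exact (isUnit_pow_iff (by have := two_le_resCard π; omega)).1 (hunit _ h2)

/-- Clearing denominators puts the local generator inside I, so that δ can be applied to relations
in A without extending it to localizations. -/
theorem IsCartier.exists_local_generator (hI : IsCartier I) (m : Ideal A) [m.IsMaximal] :
    ∃ f ∉ m, ∃ d ∈ I, ∀ x ∈ I, ∃ n y, f ^ n * x = d * y := by
  obtain ⟨s, hs, h⟩ := hI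
  obtain ⟨f, hf, hfm⟩ : ∃ f ∈ s, f ∉ m := by
    by_contra! hc
    exact (inferInstance : m.IsMaximal).ne_top (top_le_iff.1 (hs ▸ Ideal.span_le.2 hc))
  obtain ⟨e, -, he⟩ := h f hf
  have he' : e ∈ I.map (algebraMap A (Localization.Away f)) :=
    he ▸ Ideal.mem_span_singleton_self e
  obtain ⟨⟨⟨d, hd⟩, t⟩, hdt⟩ := (IsLocalization.mem_map_algebraMap_iff (Submonoid.powers f) _).1 he'
  refine ⟨f, hfm, d, hd, fun x hx => ?_⟩
  have hx' : algebraMap A (Localization.Away f) x ∈ Ideal.span {e} :=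
    he ▸ Ideal.mem_map_of_mem _ hx
  obtain ⟨c, hc⟩ := Ideal.mem_span_singleton.1 hx'
  obtain ⟨⟨w, r⟩, hw⟩ := IsLocalization.surj (Submonoid.powers f) c
  dsimp only at hdt hw
  have key : algebraMap A (Localization.Away f) ((t : A) * r * x) =
      algebraMap A (Localization.Away f) (d * w) := by
    rw [map_mul, map_mul, map_mul, ← hdt, ← hw, hc]; ring
  obtain ⟨g, hg⟩ := (IsLocalization.eq_iff_exists (Submonoid.powers f) _).1 key
  obtain ⟨i, hi⟩ := t.2
  obtain ⟨j, hj⟩ := r.2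
  obtain ⟨k, hk⟩ := g.2
  dsimp only at hi hj hk
  refine ⟨k + i + j, (g : A) * w, ?_⟩
  rw [← hi, ← hj, ← hk] at hg
  rw [← hk]
  linear_combination hg

/-- Near a maximal ideal m, which contains (π, I) by the Jacobson property, write b as a local
generator d times z. If z were in m, applying δ to this product would put δ(b) in m; so z is a unit
at m and b generates I there. -/
theorem IsLPrism.eq_span_of_distinguished (hI : IsLPrism π I) {b : A} (hb : b ∈ I)
    (hu : IsUnit (δ π b)) : I = Ideal.span {b} := by
  have hq := two_le_resCard π
  refine le_antisymm (fun x hx => ?_) ((Ideal.span_singleton_le_iff_mem I).2 hb)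
  by_contra hxb
  have hne : (Ideal.span {b}).colon {x} ≠ ⊤ := fun h => hxb (by
    have : (1 : A) ∈ (Ideal.span {b}).colon {x} := h ▸ Submodule.mem_top
    rwa [Submodule.mem_colon_singleton, one_smul] at this)
  obtain ⟨m, hm, hle⟩ := Ideal.exists_le_maximal _ hne
  have hJ : Ideal.span {algebraMap O A π} ⊔ I ≤ m := by
    refine hI.isDerivedComplete.le_jacobson.trans ?_
    rw [Ring.jacobson_eq_sInf_isMaximal]
    exact sInf_le hm
  obtain ⟨f, hf, d, hd, h⟩ := hI.isCartier.exists_local_generator m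
  obtain ⟨n, y, hy⟩ := h x hx
  obtain ⟨k, z, hz⟩ := h b hb
  have hz' : z ∉ m := fun hzm => by
    -- Since π ∈ m, φ agrees with the q-th power modulo m.
    have hφ : ∀ t ∈ m, frobHom π A t ∈ m := fun t ht => by
      rw [frobHom_apply]
      exact add_mem (Ideal.pow_mem_of_mem _ ht _ (by omega)) (m.mul_mem_right _
        (hJ (Ideal.mem_sup_left (Ideal.mem_span_singleton_self _))))
    have h1 := congrArg (δ π) hz
    rw [delta_mul, delta_mul] at h1
    have h2 : (f ^ k) ^ resCard π * δ π b ∈ m := by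
      rw [show (f ^ k) ^ resCard π * δ π b = δ π d * frobHom π A z + d ^ resCard π * δ π z -
        δ π (f ^ k) * frobHom π A b by linear_combination h1]
      exact sub_mem (add_mem (m.mul_mem_left _ (hφ _ hzm)) (m.mul_mem_right _
        (Ideal.pow_mem_of_mem _ (hJ (Ideal.mem_sup_right hd)) _ (by omega))))
        (m.mul_mem_left _ (hφ _ (hJ (Ideal.mem_sup_right hb))))
    rcases hm.isPrime.mem_or_mem h2 with h3 | h3
    · exact hf (hm.isPrime.mem_of_pow_mem _ (hm.isPrime.mem_of_pow_mem _ h3))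
    · exact hm.ne_top (Ideal.eq_top_of_isUnit_mem _ h3 hu)
  -- From f^k b = d z and f^n x = d y one gets z f^n x = f^k y b.
  have h3 : z * f ^ n ∈ m := hle (by
    rw [Submodule.mem_colon_singleton, smul_eq_mul, Ideal.mem_span_singleton]
    exact ⟨f ^ k * y, by linear_combination z * hy - y * hz⟩)
  rcases hm.isPrime.mem_or_mem h3 with h4 | h4
  · exact hz' h4
  · exact hf (hm.isPrime.mem_of_pow_mem _ h4)

theorem IsCartier.mem_nonZeroDivisors {b : A} (h : IsCartier (Ideal.span {b})) :
    b ∈ nonZeroDivisors A := by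
  obtain ⟨s, hs, h⟩ := h
  rw [mem_nonZeroDivisors_iff_right]
  intro c hc
  by_contra hne
  have hne' : (⊥ : Ideal A).colon {c} ≠ ⊤ := fun h => hne (by
    have : (1 : A) ∈ (⊥ : Ideal A).colon {c} := h ▸ Submodule.mem_top
    rwa [Submodule.mem_colon_singleton, one_smul] at this)
  obtain ⟨m, hm, hle⟩ := Ideal.exists_le_maximal _ hne'
  obtain ⟨f, hf, hfm⟩ : ∃ f ∈ s, f ∉ m := by
    by_contra! hc
    exact hm.ne_top (top_le_iff.1 (hs ▸ Ideal.span_le.2 hc))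
  obtain ⟨d, hd, he⟩ := h f hf
  rw [Ideal.map_span, Set.image_singleton] at he
  obtain ⟨w, hw⟩ := Ideal.mem_span_singleton.1 (he ▸ Ideal.mem_span_singleton_self d)
  -- The local generator d is a multiple of b, so c b = 0 forces c d = 0, and c dies in the
  -- localization.
  have h0 : algebraMap A (Localization.Away f) c = 0 := by
    rw [mem_nonZeroDivisors_iff_right] at hd
    refine hd _ ?_
    rw [hw, ← mul_assoc, ← map_mul, hc, map_zero, zero_mul]
  obtain ⟨⟨_, k, rfl⟩, hg⟩ := (IsLocalization.map_eq_zero_iff (Submonoid.powers f) _ c).1 h0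
  exact hfm (hm.isPrime.mem_of_pow_mem k (hle (by
    rw [Submodule.mem_colon_singleton]; simpa using hg)))

theorem isCartier_span_singleton {b : A} (hb : b ∈ nonZeroDivisors A) :
    IsCartier (Ideal.span {b}) := by
  refine ⟨{1}, Ideal.span_singleton_one, ?_⟩
  rintro _ rfl
  refine ⟨algebraMap A _ b, ?_, by rw [Ideal.map_span, Set.image_singleton]⟩
  exact IsLocalization.map_nonZeroDivisors_le (Submonoid.powers (1 : A)) _
    (Submonoid.mem_map_of_mem _ hb)

theorem IsLPrism.exists_generator (hI : IsLPrism π I) (hA : IsPerfectDelta π A) :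
    ∃ b, I = Ideal.span {b} ∧ IsUnit (δ π b) ∧ b ∈ nonZeroDivisors A := by
  obtain ⟨b, hb, hu⟩ := hI.exists_distinguished hA
  have h := hI.eq_span_of_distinguished hb hu
  exact ⟨b, h, hu, (h ▸ hI.isCartier).mem_nonZeroDivisors⟩

end Principal

/-! ### The reduction A / π, completeness of A / I, and the tilt. -/

section Reduction

variable {O : Type v} [CommRing O] {π : O} {A : Type u} [CommRing A] [Algebra O A]

theorem modPi_eq_zero_iff {R : Type u} [CommRing R] [Algebra O R] {x : R} :
    modPi π R x = 0 ↔ algebraMap O R π ∣ x :=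
  Ideal.Quotient.eq_zero_iff_mem.trans Ideal.mem_span_singleton

theorem modPi_surjective (R : Type u) [CommRing R] [Algebra O R] :
    Function.Surjective (modPi π R) :=
  Ideal.Quotient.mk_surjective

variable {I : Ideal A} {b : A}

theorem modPi_quotient_eq_zero_iff (hI : I = Ideal.span {b}) {x : A} :
    modPi π (A ⧸ I) (Ideal.Quotient.mkₐ O I x) = 0 ↔ modPi π A b ∣ modPi π A x := by
  rw [modPi_eq_zero_iff, ← AlgHom.commutes (Ideal.Quotient.mkₐ O I)]
  constructor
  · rintro ⟨c, hc⟩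
    obtain ⟨c, rfl⟩ := Ideal.Quotient.mkₐ_surjective O I c
    rw [← map_mul, ← sub_eq_zero, ← map_sub, Ideal.Quotient.mkₐ_eq_mk,
      Ideal.Quotient.eq_zero_iff_mem, hI, Ideal.mem_span_singleton] at hc
    have := map_dvd (modPi π A) hc
    rwa [map_sub, map_mul, AlgHom.commutes, mk_algebraMap_pi, zero_mul, sub_zero] at this
  · rintro ⟨c, hc⟩
    obtain ⟨c, rfl⟩ := modPi_surjective (π := π) A c
    rw [← map_mul, ← sub_eq_zero, ← map_sub, modPi_eq_zero_iff] at hc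
    have := map_dvd (Ideal.Quotient.mkₐ O I) hc
    have hb : Ideal.Quotient.mkₐ O I b = 0 :=
      Ideal.Quotient.eq_zero_iff_mem.2 (hI ▸ Ideal.mem_span_singleton_self b)
    rwa [map_sub, map_mul, hb, zero_mul, sub_zero] at this

theorem modPi_bijective
    (hc : IsDerivedComplete (Ideal.span {algebraMap O A π} ⊔ I)) (hb : b ∈ I) :
    Function.Bijective fun (x : ℕ → A ⧸ piIdeal π A) (n : ℕ) =>
      x n - modPi π A b * x (n + 1) :=
  bijective_quotient_span_singleton (hc b (Ideal.mem_sup_right hb))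

end Reduction

section PerfectReduction

variable {O : Type v} [CommRing O] {π : O} [IsUniformizer π] {A : Type u} [CommRing A]
  [Algebra O A] [DeltaAlgebra π A]

open DeltaAlgebra

theorem modPi_frobHom (x : A) : modPi π A (frobHom π A x) = modPi π A x ^ resCard π := by
  rw [← map_pow, ← sub_eq_zero, ← map_sub, modPi_eq_zero_iff]
  exact dvd_frobHom_sub x

theorem modPi_frobHom_pow (n : ℕ) (x : A) :
    modPi π A ((frobHom π A ^ n) x) = modPi π A x ^ resCard π ^ n := by
  induction n with
  | zero => simp
  | succ n ih => rw [pow_succ', AlgHom.mul_apply, modPi_frobHom, ih, ← pow_mul, pow_succ]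

/-- The inverse of Frobenius on a perfect `δ_L`-algebra. -/
noncomputable def frobInv (hA : IsPerfectDelta π A) : A →ₐ[O] A :=
  (AlgEquiv.ofBijective (frobHom π A) hA).symm

theorem frobHom_mul_frobInv (hA : IsPerfectDelta π A) : frobHom π A * frobInv hA = 1 :=
  AlgHom.ext fun x => (AlgEquiv.ofBijective (frobHom π A) hA).apply_symm_apply x

theorem frobInv_mul_frobHom (hA : IsPerfectDelta π A) : frobInv hA * frobHom π A = 1 :=
  AlgHom.ext fun x => (AlgEquiv.ofBijective (frobHom π A) hA).symm_apply_apply x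

theorem frobHom_pow_frobInv_pow (hA : IsPerfectDelta π A) (n : ℕ) (x : A) :
    (frobHom π A ^ n) ((frobInv hA ^ n) x) = x := by
  rw [← AlgHom.mul_apply, pow_mul_pow_eq_one n (frobHom_mul_frobInv hA), AlgHom.one_apply]

theorem frobHom_frobInv_pow_succ (hA : IsPerfectDelta π A) (n : ℕ) (x : A) :
    frobHom π A ((frobInv hA ^ (n + 1)) x) = (frobInv hA ^ n) x := by
  rw [← AlgHom.mul_apply, pow_succ', ← mul_assoc, frobHom_mul_frobInv, one_mul]

theorem isReduced_modPi (hA : IsPerfectDelta π A) : IsReduced (A ⧸ piIdeal π A) := by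
  refine (isReduced_iff_pow_one_lt (resCard π) (two_le_resCard π)).2 fun x hx => ?_
  obtain ⟨x, rfl⟩ := modPi_surjective (π := π) A x
  rw [← modPi_frobHom, modPi_eq_zero_iff] at hx
  rw [modPi_eq_zero_iff]
  have := map_dvd (frobInv hA) hx
  rwa [AlgHom.commutes, ← AlgHom.mul_apply, frobInv_mul_frobHom] at this

/-- On the perfect ring A / π the map φⁿ is the bijection x ↦ x^(qⁿ), so it preserves and reflects
divisibility. -/
theorem dvd_modPi_frobHom_pow_iff (hA : IsPerfectDelta π A) (n : ℕ) (b y : A) :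
    modPi π A b ^ resCard π ^ n ∣ modPi π A ((frobHom π A ^ n) y) ↔
      modPi π A b ∣ modPi π A y := by
  have := isReduced_modPi hA
  refine ⟨?_, fun h => ?_⟩
  · rintro ⟨c, hc⟩
    obtain ⟨c, rfl⟩ := modPi_surjective (π := π) A c
    rw [← frobHom_pow_frobInv_pow hA n c, ← modPi_frobHom_pow, ← map_mul, ← map_mul,
      ← sub_eq_zero, ← map_sub, ← map_sub, modPi_frobHom_pow] at hc
    have := eq_zero_of_pow_eq_zero hc
    rw [map_sub, sub_eq_zero, map_mul] at this
    exact ⟨_, this⟩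
  · rw [modPi_frobHom_pow]
    exact pow_dvd_pow_of_dvd h _

variable {I : Ideal A} {b : A}

/-- Compare φ of the relation with its q-th power: the difference is divisible by π and gives δ(b)
y^q + b^q δ(y) ≡ 0 modulo π. Multiplying by y^q removes the second term, as b^q y^q = π^(2q) x^q.
Thus π divides δ(b) y^(2q), and δ(b) is a unit while A / π is reduced. -/
theorem dvd_of_pi_sq_mul_eq (hA : IsPerfectDelta π A) (hb : IsUnit (δ π b)) {x y : A}
    (h : algebraMap O A π ^ 2 * x = b * y) : algebraMap O A π ∣ y := by
  have := isReduced_modPi hA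
  obtain ⟨m, hm⟩ : ∃ m, resCard π = m + 2 := ⟨resCard π - 2, by have := two_le_resCard π; omega⟩
  have h1 := congrArg (frobHom π A) h
  rw [map_mul, map_mul, map_pow, AlgHom.commutes, frobHom_apply b, frobHom_apply y] at h1
  have h2 := congrArg (· ^ resCard π) h
  simp only [mul_pow] at h2
  rw [← pow_mul, hm, show 2 * (m + 2) = 2 * m + 4 by ring] at h2
  rw [hm] at h1
  have h3 : δ π b * y ^ (m + 2) + b ^ (m + 2) * δ π y = algebraMap O A π * (frobHom π A x -
      δ π b * δ π y - algebraMap O A π ^ (2 * m + 2) * x ^ (m + 2)) := by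
    refine sub_eq_zero.1 (regular_of_injective hA.1 ?_)
    linear_combination -h1 + h2
  have h4 : algebraMap O A π ∣ δ π b * y ^ (2 * (m + 2)) :=
    ⟨(frobHom π A x - δ π b * δ π y - algebraMap O A π ^ (2 * m + 2) * x ^ (m + 2)) *
      y ^ (m + 2) - algebraMap O A π ^ (2 * m + 3) * x ^ (m + 2) * δ π y, by
      linear_combination y ^ (m + 2) * h3 + δ π y * h2⟩
  rw [hb.dvd_mul_left, ← modPi_eq_zero_iff, map_pow] at h4
  exact modPi_eq_zero_iff.1 (eq_zero_of_pow_eq_zero h4)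

theorem pi_mul_eq_zero_of_pow (hA : IsPerfectDelta π A) (hI : I = Ideal.span {b})
    (hb : IsUnit (δ π b)) (n : ℕ) (x : A ⧸ I) (h : algebraMap O (A ⧸ I) π ^ n * x = 0) :
    algebraMap O (A ⧸ I) π * x = 0 := by
  have key : ∀ z : A ⧸ I, algebraMap O (A ⧸ I) π ^ 2 * z = 0 →
      algebraMap O (A ⧸ I) π * z = 0 := by
    intro z hz
    obtain ⟨z, rfl⟩ := Ideal.Quotient.mkₐ_surjective O I z
    rw [← AlgHom.commutes (Ideal.Quotient.mkₐ O I)] at hz ⊢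
    rw [← map_pow, ← map_mul, Ideal.Quotient.mkₐ_eq_mk, Ideal.Quotient.eq_zero_iff_mem, hI,
      Ideal.mem_span_singleton] at hz
    rw [← map_mul, Ideal.Quotient.mkₐ_eq_mk, Ideal.Quotient.eq_zero_iff_mem, hI,
      Ideal.mem_span_singleton]
    obtain ⟨y, hy⟩ := hz
    obtain ⟨w, rfl⟩ := dvd_of_pi_sq_mul_eq hA hb hy
    exact ⟨w, sub_eq_zero.1 (regular_of_injective hA.1 (by linear_combination hy))⟩
  induction n with
  | zero => rw [pow_zero, one_mul] at h; rw [h, mul_zero]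
  | succ n ih =>
    cases n with
    | zero => simpa using h
    | succ n => exact ih (by
        have := key (algebraMap O (A ⧸ I) π ^ n * x) (by rw [← h]; ring)
        rw [← this]; ring)

theorem isAdicComplete_quotient (hA : IsPerfectDelta π A) (hI : I = Ideal.span {b})
    (hb : IsUnit (δ π b))
    (hc : IsDerivedComplete (Ideal.span {algebraMap O A π} ⊔ I)) :
    IsAdicComplete (piIdeal π (A ⧸ I)) (A ⧸ I) := by
  refine isAdicComplete_span_singleton ?_ (pi_mul_eq_zero_of_pow hA hI hb)
  have := hc _ (Ideal.mem_sup_left (Ideal.mem_span_singleton_self _))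
  subst hI
  exact bijective_quotient_span_singleton this

/-- The map from a perfect prism `(A, I)` to the tilt of `A / I`. -/
noncomputable def toTilt (hA : IsPerfectDelta π A) (I : Ideal A) : A →ₐ[O] Tilt π (A ⧸ I) :=
  AlgHom.codRestrict (AlgHom.pi fun n =>
    (modPi π (A ⧸ I)).comp ((Ideal.Quotient.mkₐ O I).comp (frobInv hA ^ n))) (Tilt π (A ⧸ I))
    fun x n => by
      change (modPi π (A ⧸ I) (Ideal.Quotient.mkₐ O I ((frobInv hA ^ (n + 1)) x))) ^ resCard π =
        modPi π (A ⧸ I) (Ideal.Quotient.mkₐ O I ((frobInv hA ^ n) x))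
      rw [← frobHom_frobInv_pow_succ hA n, frobHom_apply]
      simp only [map_add, map_mul, map_pow, AlgHom.commutes, mk_algebraMap_pi, zero_mul, add_zero]

theorem coord_toTilt (hA : IsPerfectDelta π A) (I : Ideal A) (n : ℕ) (x : A) :
    Tilt.coord π n (toTilt hA I x) =
      modPi π (A ⧸ I) (Ideal.Quotient.mkₐ O I ((frobInv hA ^ n) x)) := rfl

theorem modPi_torsion (hA : IsPerfectDelta π A) (n : ℕ) (x : A ⧸ piIdeal π A)
    (h : modPi π A b ^ n * x = 0) : modPi π A b * x = 0 := by
  have := isReduced_modPi hA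
  refine eq_zero_of_pow_eq_zero (n := n + 1) ?_
  rw [mul_pow]
  linear_combination modPi π A b * x ^ n * h

/-- Vanishing of the n-th coordinate means that b^(qⁿ) divides x modulo π; b-adic separatedness of A
/ π concludes. -/
theorem toTilt_eq_zero_iff (hA : IsPerfectDelta π A) (hI : I = Ideal.span {b})
    (hc : IsDerivedComplete (Ideal.span {algebraMap O A π} ⊔ I)) {x : A} :
    toTilt hA I x = 0 ↔ algebraMap O A π ∣ x := by
  constructor
  · intro h
    rw [← modPi_eq_zero_iff]
    refine eq_zero_of_forall_pow_dvd
      (modPi_bijective hc (hI ▸ Ideal.mem_span_singleton_self b)).1 (modPi_torsion hA) fun n => ?_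
    have h1 : modPi π (A ⧸ I) (Ideal.Quotient.mkₐ O I ((frobInv hA ^ n) x)) = 0 := by
      rw [← coord_toTilt, h, map_zero]
    rw [modPi_quotient_eq_zero_iff hI, ← dvd_modPi_frobHom_pow_iff hA n,
      frobHom_pow_frobInv_pow] at h1
    exact (pow_dvd_pow _ (Nat.lt_pow_self (two_le_resCard π)).le).trans h1
  · rintro ⟨c, rfl⟩
    refine Subtype.ext (funext fun n => ?_)
    change Tilt.coord π n (toTilt hA I _) = 0
    rw [map_mul, map_mul, AlgHom.commutes, AlgHom.commutes, mk_algebraMap_pi, zero_mul]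

/-- Lift the coordinates of t to yₙ. The elements φⁿ(yₙ) form a b-adic Cauchy sequence modulo π, and
its limit is the preimage. -/
theorem toTilt_surjective (hA : IsPerfectDelta π A) (hI : I = Ideal.span {b})
    (hc : IsDerivedComplete (Ideal.span {algebraMap O A π} ⊔ I)) :
    Function.Surjective (toTilt hA I) := by
  intro t
  have hs : ∀ n, ∃ y : A, modPi π (A ⧸ I) (Ideal.Quotient.mkₐ O I y) = Tilt.coord π n t := by
    intro n
    obtain ⟨r, hr⟩ := modPi_surjective (π := π) (A ⧸ I) (Tilt.coord π n t)
    obtain ⟨y, rfl⟩ := Ideal.Quotient.mkₐ_surjective O I r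
    exact ⟨y, hr⟩
  choose y hy using hs
  have hq : ∀ n, n ≤ resCard π ^ n := fun n => (Nat.lt_pow_self (two_le_resCard π)).le
  have hstep : ∀ n, modPi π A b ^ resCard π ^ n ∣
      modPi π A ((frobHom π A ^ (n + 1)) (y (n + 1))) - modPi π A ((frobHom π A ^ n) (y n)) := by
    intro n
    rw [pow_succ, AlgHom.mul_apply, ← map_sub, ← map_sub, dvd_modPi_frobHom_pow_iff hA,
      ← modPi_quotient_eq_zero_iff hI, map_sub, map_sub, hy, frobHom_apply]
    simp only [map_add, map_mul, map_pow, AlgHom.commutes, mk_algebraMap_pi, zero_mul, add_zero]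
    rw [hy, sub_eq_zero]
    exact t.2 n
  obtain ⟨l, hl⟩ := exists_forall_sub_dvd
    (modPi_bijective hc (hI ▸ Ideal.mem_span_singleton_self b)).2
    (z := fun n => modPi π A ((frobHom π A ^ n) (y n)))
    fun n => (pow_dvd_pow _ (hq n)).trans (hstep n)
  have hchain : ∀ n k, modPi π A b ^ resCard π ^ n ∣
      modPi π A ((frobHom π A ^ (n + k)) (y (n + k))) - modPi π A ((frobHom π A ^ n) (y n)) := by
    intro n k
    induction k with
    | zero => simp
    | succ k ih =>
      refine (dvd_add ((pow_dvd_pow _ (Nat.pow_le_pow_right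
        (by have := two_le_resCard π; omega) (Nat.le_add_right n k))).trans
        (hstep (n + k))) ih).trans (dvd_of_eq (sub_add_sub_cancel _ _ _))
  obtain ⟨z, rfl⟩ := modPi_surjective (π := π) A l
  refine ⟨z, Subtype.ext (funext fun n => ?_)⟩
  change Tilt.coord π n (toTilt hA I z) = Tilt.coord π n t
  rw [coord_toTilt, ← hy n, ← sub_eq_zero, ← map_sub, ← map_sub, modPi_quotient_eq_zero_iff hI,
    ← dvd_modPi_frobHom_pow_iff hA n, map_sub, frobHom_pow_frobInv_pow, map_sub]
  -- The limit is known modulo b^(n+k) at stage n + k; taking n + k = qⁿ gives the precision b^(qⁿ)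
  -- needed for the n-th coordinate.
  obtain ⟨k, hk⟩ := Nat.exists_eq_add_of_le (hq n)
  have h1 := hl (n + k)
  nth_rw 1 [← hk] at h1
  have h2 := dvd_sub (hchain n k) h1
  refine h2.trans (dvd_of_eq (by ring))

end PerfectReduction

/-! ### The δ-structure as a section A → W_L(A). -/

section WittSection

variable {O : Type v} [CommRing O] {π : O} [IsUniformizer π] {A : Type u} [CommRing A]
  [Algebra O A] [DeltaAlgebra π A]

open DeltaAlgebra

/-- The Witt vector with ghost components `x, φ(x), φ²(x), …`. -/
noncomputable def wittSection (π : O) [IsUniformizer π] {A : Type u} [CommRing A] [Algebra O A]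
    [DeltaAlgebra π A] (x : A) : Witt π A :=
  ⟨ghostInv π fun n => (frobHom π A ^ n) x⟩

theorem ghostHom_wittSection (n : ℕ) (x : A) :
    Witt.ghostHom n (wittSection π x) = (frobHom π A ^ n) x :=
  -- Dwork's congruences hold trivially: consecutive prescribed ghost components are exactly related
  -- by φ.
  ghostSeq_ghostInv π (frobHom π A) dvd_frobHom_sub _ (fun n => by
    rw [← AlgHom.mul_apply, ← pow_succ', sub_self]; exact dvd_zero _) n

theorem coeff_zero_eq_ghostHom {R : Type u} [CommRing R] [Algebra O R] (w : Witt π R) :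
    w.coeff 0 = Witt.ghostHom 0 w := by
  change _ = ghostSeq π 0 w.coeff
  simp [ghostSeq]

theorem wittSection_coeff_zero (x : A) : (wittSection π x).coeff 0 = x := by
  rw [coeff_zero_eq_ghostHom, ghostHom_wittSection, pow_zero, AlgHom.one_apply]

/-- The section `A → W_L(A)` as an algebra map. -/
noncomputable def wittSectionHom (hA : ∀ x : A, algebraMap O A π * x = 0 → x = 0) :
    A →ₐ[O] Witt π A :=
  have h : ∀ {u w : Witt π A}, (∀ n, Witt.ghostHom n u = Witt.ghostHom n w) → u = w :=
    fun h => Witt.ghost_ext hA h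
  { toFun := wittSection π
    map_zero' := h fun n => by rw [ghostHom_wittSection, map_zero, map_zero]
    map_one' := h fun n => by rw [ghostHom_wittSection, map_one, map_one]
    map_add' := fun x y => h fun n => by
      rw [map_add]; simp only [ghostHom_wittSection, map_add]
    map_mul' := fun x y => h fun n => by
      rw [map_mul]; simp only [ghostHom_wittSection, map_mul]
    commutes' := fun α => h fun n => by
      rw [ghostHom_wittSection, AlgHom.commutes, AlgHom.commutes] }

theorem wittSection_delta (hA : ∀ x : A, algebraMap O A π * x = 0 → x = 0) (x : A) :
    wittSection π (δ π x) = Witt.delta (wittSection π x) :=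
  Witt.delta_ext hA fun n => by
    rw [Witt.ghostHom_delta]
    simp only [ghostHom_wittSection]
    rw [pow_succ, AlgHom.mul_apply, frobHom_apply, map_add, map_mul, AlgHom.commutes, map_pow,
      add_sub_cancel_left]

theorem map_wittSection {B : Type u} [CommRing B] [Algebra O B] [DeltaAlgebra π B]
    (hB : ∀ x : B, algebraMap O B π * x = 0 → x = 0) (f : A →ₐ[O] B)
    (hf : ∀ x, f (frobHom π A x) = frobHom π B (f x)) (x : A) :
    Witt.map f (wittSection π x) = wittSection π (f x) := by
  have hn : ∀ n x, f ((frobHom π A ^ n) x) = (frobHom π B ^ n) (f x) := by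
    intro n
    induction n with
    | zero => exact fun _ => rfl
    | succ n ih => intro x; rw [pow_succ, AlgHom.mul_apply, ih, hf, pow_succ, AlgHom.mul_apply]
  refine Witt.ghost_ext hB fun n => ?_
  change _ = Witt.ghostHom n (wittSection π (f x))
  rw [ghostHom_wittSection, ← hn, ← ghostHom_wittSection]
  exact ghostSeq_map π f n _

end WittSection

/-! ### Multiplication by π on Witt vectors when π = 0. -/

section Verschiebung

variable {O : Type v} [CommRing O] {π : O} [IsUniformizer π]

/-- Converse of `ghostSeq_congr`: by induction the earlier terms agree modulo π^(n+1), leaving πⁿ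
(xₙ - yₙ), from which πⁿ can be cancelled. -/
theorem coeff_congr_of_ghost_congr {P : Type*} [CommRing P] [Algebra O P]
    (hP : ∀ x : P, algebraMap O P π * x = 0 → x = 0) {x y : ℕ → P}
    (h : ∀ n, algebraMap O P π ^ (n + 1) ∣ ghostSeq π n x - ghostSeq π n y) (n : ℕ) :
    algebraMap O P π ∣ x n - y n := by
  induction n using Nat.strong_induction_on with
  | _ n ih =>
    obtain ⟨c, hc⟩ : algebraMap O P π ^ (n + 1) ∣ algebraMap O P π ^ n * (x n - y n) := by
      have h1 := h n
      rw [ghostSeq, ghostSeq, Finset.sum_range_succ, Finset.sum_range_succ, Nat.sub_self, pow_zero,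
        pow_one, pow_one, add_sub_add_comm, ← mul_sub, ← Finset.sum_sub_distrib] at h1
      refine (dvd_add_right (Finset.dvd_sum fun i hi => ?_)).1 h1
      rw [Finset.mem_range] at hi
      have h2 := mul_dvd_mul_left (algebraMap O P π ^ i)
        (dvd_pow_pow_sub_pow_pow π (ih i hi) (n - i))
      rwa [← pow_add, show i + (n - i + 1) = n + 1 by omega, mul_sub] at h2
    exact ⟨c, sub_eq_zero.1 (pow_regular hP n (by rw [mul_sub, hc]; ring))⟩

/-- The sequence `0, x₀^q, x₁^q, …`. -/
noncomputable def shiftPow (π : O) {R : Type*} [CommRing R] (x : ℕ → R) : ℕ → R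
  | 0 => 0
  | n + 1 => x n ^ resCard π

/-- This is the identity π = VF when π = 0. Over a polynomial ring the n-th ghost components of π x
and of (0, x₀^q, x₁^q, …) differ by π^(n+1) xₙ, so the coordinates agree modulo π. -/
theorem coeff_algebraMap_mul {k : Type u} [CommRing k] [Algebra O k] (hk : algebraMap O k π = 0)
    (w : Witt π k) (n : ℕ) : (algebraMap O (Witt π k) π * w).coeff n =
      shiftPow π w.coeff n := by
  obtain ⟨x, rfl⟩ := Witt.exists_lift w
  have h := coeff_congr_of_ghost_congr (mvPolynomial_regular π)
    (x := (algebraMap O (Witt π (MvPolynomial k O)) π * x).coeff)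
    (y := shiftPow π x.coeff) (fun n => ?_) n
  · have h1 := map_dvd (MvPolynomial.aeval id : MvPolynomial k O →ₐ[O] k) h
    rw [AlgHom.commutes, hk, zero_dvd_iff, map_sub, sub_eq_zero] at h1
    have h2 : algebraMap O (Witt π k) π * Witt.mapFun (MvPolynomial.aeval id) x =
        Witt.map (MvPolynomial.aeval id) (algebraMap O (Witt π (MvPolynomial k O)) π * x) := by
      rw [map_mul, AlgHom.commutes]; rfl
    rw [h2]
    refine h1.trans ?_
    cases n with
    | zero => exact map_zero _
    | succ n => exact map_pow _ _ _
  · have h1 : ghostSeq π n (algebraMap O (Witt π (MvPolynomial k O)) π * x).coeff =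
        algebraMap O _ π * ghostSeq π n x.coeff := by
      change Witt.ghostHom n _ = _ * Witt.ghostHom n _
      rw [map_mul, AlgHom.commutes]
    rw [h1]
    cases n with
    | zero => simp [ghostSeq, shiftPow]
    | succ n =>
      rw [ghostSeq_succ]
      have h2 : ghostSeq π (n + 1) (shiftPow π x.coeff) = algebraMap O _ π * ghostSeq π n fun i => x.coeff i ^ resCard π := by
        rw [ghostSeq, Finset.sum_range_succ', ghostSeq, Finset.mul_sum]
        simp only [Nat.add_sub_add_right, pow_zero, one_mul, Nat.sub_zero, shiftPow]
        rw [zero_pow (pow_ne_zero _ (by have := two_le_resCard π; omega)), add_zero]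
        exact Finset.sum_congr rfl fun i _ => by ring
      rw [h2]
      exact ⟨x.coeff (n + 1), by ring⟩

/-- The coordinates of 0 come from `ghostInv`, so their vanishing is not definitional; it follows
from 0 = π · 0 and the shift formula. -/
theorem zero_coeff {k : Type u} [CommRing k] [Algebra O k] (hk : algebraMap O k π = 0) (n : ℕ) :
    (0 : Witt π k).coeff n = 0 := by
  have h := coeff_algebraMap_mul hk (0 : Witt π k) n
  rw [mul_zero] at h
  induction n with
  | zero => exact h
  | succ n ih =>
    have h1 := coeff_algebraMap_mul hk (0 : Witt π k) n
    rw [mul_zero] at h1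
    rw [h, shiftPow, ih h1, zero_pow (by have := two_le_resCard π; omega)]

end Verschiebung

/-! ### Perfect δ-algebras as Witt vectors. -/

section Bijective

variable {O : Type v} [CommRing O] {π : O} [IsUniformizer π] {A : Type u} [CommRing A]
  [Algebra O A] [DeltaAlgebra π A] {k : Type u} [CommRing k] [Algebra O k]

/-- A perfect `δ_L`-algebra that is derived `π`-complete is the ring of Witt vectors of its
reduction. -/
theorem map_wittSection_bijective (hA : IsPerfectDelta π A)
    (hc : Function.Bijective fun (x : ℕ → A) (n : ℕ) => x n - algebraMap O A π * x (n + 1))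
    (j : A →ₐ[O] k) (hj : Function.Surjective j)
    (hker : ∀ x, j x = 0 ↔ algebraMap O A π ∣ x) :
    Function.Bijective fun x : A => Witt.map (π := π) j (wittSection π x) := by
  have hreg : ∀ x : A, algebraMap O A π * x = 0 → x = 0 := fun _ => regular_of_injective hA.1
  have hk : algebraMap O k π = 0 := by
    rw [← AlgHom.commutes j]; exact (hker _).2 dvd_rfl
  have hfrob : ∀ x, j (frobHom π A x) = j x ^ resCard π := fun x => by
    rw [frobHom_apply, map_add, map_mul, AlgHom.commutes, hk, zero_mul, add_zero, map_pow]
  have hinj : ∀ x : k, x ^ resCard π = 0 → x = 0 := by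
    intro x hx
    obtain ⟨x, rfl⟩ := hj x
    rw [← hfrob, hker] at hx
    obtain ⟨c, hc⟩ := hx
    obtain ⟨c, rfl⟩ := hA.2 c
    rw [hker]
    exact ⟨c, hA.1 (show frobHom π A x = frobHom π A _ by rw [hc, map_mul, AlgHom.commutes]; rfl)⟩
  have hsurj : ∀ x : k, ∃ y, y ^ resCard π = x := by
    intro x
    obtain ⟨x, rfl⟩ := hj x
    obtain ⟨y, rfl⟩ := hA.2 x
    exact ⟨j y, (hfrob y).symm⟩
  let T : A →ₐ[O] Witt π k := (Witt.map j).comp (wittSectionHom hreg)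
  have hT0 : ∀ x, (T x).coeff 0 = j x := fun x => congrArg j (wittSection_coeff_zero x)
  change Function.Bijective T
  constructor
  · refine (injective_iff_map_eq_zero T).2 fun x hx => ?_
    -- The coordinate 0 shows that π divides x; multiplication by π is injective on W_L(k) because x
    -- ↦ x^q is injective on k. Iterating gives an infinitely π-divisible sequence in A.
    have hstep : ∀ x, T x = 0 → ∃ y, T y = 0 ∧ x = algebraMap O A π * y := by
      intro x hx
      obtain ⟨y, rfl⟩ := (hker x).1 (by
        rw [← hT0, hx, coeff_zero_eq_ghostHom, map_zero])
      refine ⟨y, ?_, rfl⟩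
      rw [map_mul, AlgHom.commutes] at hx
      refine Witt.ext (funext fun n => ?_)
      have h1 := coeff_algebraMap_mul hk (T y) (n + 1)
      rw [hx] at h1
      rw [zero_coeff hk] at h1 ⊢
      exact hinj _ h1.symm
    choose g hg0 hg using hstep
    let s : ℕ → {x // T x = 0} := fun n => (fun z => ⟨g z.1 z.2, hg0 z.1 z.2⟩)^[n] ⟨x, hx⟩
    have := eq_zero_of_forall_eq_mul_succ hc.1 (x := fun n => (s n).1) fun n => by
      simp only [s, Function.iterate_succ_apply']
      exact hg _ _
    exact congrFun this 0
  · intro w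
    -- A Witt vector with vanishing coordinate 0 is a multiple of π, because every element of k is a
    -- q-th power.
    have hdecomp : ∀ w : Witt π k, ∃ x w', w = T x + algebraMap O _ π * w' := by
      intro w
      obtain ⟨x, hx⟩ := hj (w.coeff 0)
      choose r hr using fun n => hsurj ((w - T x).coeff (n + 1))
      refine ⟨x, ⟨r⟩, eq_add_of_sub_eq' (Witt.ext (funext fun n => ?_))⟩
      rw [coeff_algebraMap_mul hk]
      cases n with
      | zero =>
        rw [coeff_zero_eq_ghostHom, map_sub, ← coeff_zero_eq_ghostHom, ← coeff_zero_eq_ghostHom,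
          hT0, hx, sub_self, shiftPow]
      | succ n => exact (hr n).symm
    choose g r hgr using hdecomp
    let s : ℕ → Witt π k := fun n => r^[n] w
    have hs : ∀ n, s n = T (g (s n)) + algebraMap O _ π * s (n + 1) := fun n => by
      simp only [s, Function.iterate_succ_apply']
      exact hgr _
    -- Derived completeness sums the digits g(sₙ): y₀ stands for ∑ πⁿ g(sₙ).
    obtain ⟨y, hy⟩ := hc.2 fun n => g (s n)
    have hy' : ∀ n, y n - algebraMap O A π * y (n + 1) = g (s n) := congrFun hy
    have he : ∀ n, s n - T (y n) = algebraMap O _ π * (s (n + 1) - T (y (n + 1))) := by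
      intro n
      have h1 := congrArg T (hy' n)
      rw [map_sub, map_mul, AlgHom.commutes] at h1
      linear_combination hs n - h1
    -- Each factor π shifts the coordinates by one, so a compatible π-divisible sequence in W_L(k)
    -- vanishes coordinate by coordinate.
    have hz : ∀ m n, (s n - T (y n)).coeff m = 0 := by
      intro m
      induction m with
      | zero => intro n; rw [he, coeff_algebraMap_mul hk, shiftPow]
      | succ m ih =>
        intro n
        rw [he, coeff_algebraMap_mul hk, shiftPow, ih, zero_pow (by have := two_le_resCard π; omega)]
    refine ⟨y 0, (sub_eq_zero.1 (Witt.ext (funext fun m => ?_))).symm⟩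
    rw [zero_coeff hk]
    exact hz m 0

end Bijective

/-! ### Comparison of A with A_inf(A / I). -/

section Maps

variable {O : Type v} [CommRing O] {π : O}

open DeltaAlgebra in
theorem map_frob {A B : Type u} [CommRing A] [Algebra O A] [DeltaAlgebra π A]
    [CommRing B] [Algebra O B] [DeltaAlgebra π B] {f : A →ₐ[O] B}
    (hf : ∀ x, f (δ π x) = δ π (f x)) (x : A) :
    f (frob π x) = frob π (f x) := by
  rw [frob, frob, map_add, map_mul, map_pow, AlgHom.commutes, hf]

theorem isAdicComplete_of_algEquiv {R S : Type u} [CommRing R] [Algebra O R] [CommRing S]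
    [Algebra O S] (e : R ≃ₐ[O] S) (h : IsAdicComplete (piIdeal π R) R) :
    IsAdicComplete (piIdeal π S) S where
  haus' x hx := by
    refine e.symm.injective ((h.haus _ fun n => ?_).trans (map_zero _).symm)
    have := hx n
    rw [SModEq.sub_mem, smul_eq_mul, Ideal.mul_top, mem_piIdeal_pow, sub_zero] at this ⊢
    simpa using map_dvd e.symm this
  prec' f hf := by
    obtain ⟨l, hl⟩ := h.prec (f := fun n => e.symm (f n)) fun {m n} hmn => by
      have := hf hmn
      rw [SModEq.sub_mem, smul_eq_mul, Ideal.mul_top, mem_piIdeal_pow] at this ⊢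
      simpa using map_dvd e.symm this
    refine ⟨e l, fun n => ?_⟩
    have := hl n
    rw [SModEq.sub_mem, smul_eq_mul, Ideal.mul_top, mem_piIdeal_pow] at this ⊢
    simpa using map_dvd e this

end Maps

section Comparison

variable {O : Type v} [CommRing O] {π : O} [IsUniformizer π] {A : Type u} [CommRing A]
  [Algebra O A] [DeltaAlgebra π A] {I : Ideal A}

open DeltaAlgebra

/-- The comparison map `A → A_inf(A / I)` for a perfect prism `(A, I)`. -/
noncomputable def toAinf (hA : IsPerfectDelta π A) (I : Ideal A) : A →ₐ[O] Ainf π (A ⧸ I) :=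
  (Witt.map (toTilt hA I)).comp (wittSectionHom fun _ => regular_of_injective hA.1)

theorem toAinf_bijective (hA : IsPerfectDelta π A) (hI : IsLPrism π I) :
    Function.Bijective (toAinf hA I) := by
  obtain ⟨b, hb, -, -⟩ := hI.exists_generator hA
  exact map_wittSection_bijective hA
    (hI.isDerivedComplete _ (Ideal.mem_sup_left (Ideal.mem_span_singleton_self _))) (toTilt hA I)
    (toTilt_surjective hA hb hI.isDerivedComplete)
    (fun _ => toTilt_eq_zero_iff hA hb hI.isDerivedComplete)

theorem toAinf_delta (hA : IsPerfectDelta π A) (I : Ideal A) (x : A) :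
    toAinf hA I (δ π x) = δ π (toAinf hA I x) := by
  change Witt.map (toTilt hA I) (wittSection π (δ π x)) = _
  rw [wittSection_delta fun _ => regular_of_injective hA.1]
  exact Witt.mapFun_delta _ _

theorem IsLPrism.isAdicComplete (hI : IsLPrism π I) (hA : IsPerfectDelta π A) :
    IsAdicComplete (piIdeal π (A ⧸ I)) (A ⧸ I) := by
  obtain ⟨b, hb, hu, -⟩ := hI.exists_generator hA
  exact isAdicComplete_quotient hA hb hu hI.isDerivedComplete

theorem frobHom_frobInv_pow (hA : IsPerfectDelta π A) (n : ℕ) (x : A) :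
    (frobInv hA ^ n) (frobHom π A x) = frobHom π A ((frobInv hA ^ n) x) := by
  have : Commute (frobInv hA) (frobHom π A) :=
    (frobInv_mul_frobHom hA).trans (frobHom_mul_frobInv hA).symm
  exact DFunLike.congr_fun (this.pow_left n) x

/-- Modulo π^(n+1), θ is the n-th ghost component of any lift of the n-th tilt coordinates. The
section of φ⁻ⁿ(x), pushed to A / I, is such a lift, and its n-th ghost component is φⁿ(φ⁻ⁿ(x)) = x.
-/
theorem theta_toAinf (hA : IsPerfectDelta π A)
    (hR : IsAdicComplete (piIdeal π (A ⧸ I)) (A ⧸ I)) (x : A) :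
    theta hR (toAinf hA I x) = Ideal.Quotient.mk I x := by
  refine (eq_of_forall_dvd hR fun n => ?_).symm
  have h1 := thetaFun_spec hR (toAinf hA I x) n
    (Witt.map (Ideal.Quotient.mkₐ O I) (wittSection π ((frobInv hA ^ n) x))) ?_
  · have h2 : Witt.ghostHom n
        (Witt.map (Ideal.Quotient.mkₐ O I) (wittSection π ((frobInv hA ^ n) x))) =
        Ideal.Quotient.mk I x := by
      refine (ghostSeq_map π (Ideal.Quotient.mkₐ O I) n _).trans (congrArg (Ideal.Quotient.mk I) ?_)
      exact (ghostHom_wittSection n _).trans (frobHom_pow_frobInv_pow hA n x)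
    rwa [h2] at h1
  · rw [← map_wittSection (fun _ => regular_of_injective hA.1) _ (frobHom_frobInv_pow hA n)]
    rfl

theorem toAinf_mem_ker_theta_iff (hA : IsPerfectDelta π A)
    (hR : IsAdicComplete (piIdeal π (A ⧸ I)) (A ⧸ I)) (x : A) :
    toAinf hA I x ∈ RingHom.ker (theta hR) ↔ x ∈ I := by
  rw [RingHom.mem_ker, theta_toAinf, Ideal.Quotient.eq_zero_iff_mem]

section Naturality

variable {B : Type u} [CommRing B] [Algebra O B] [DeltaAlgebra π B] {J : Ideal B}

theorem map_frobInv_pow (hA : IsPerfectDelta π A) (hB : IsPerfectDelta π B) {f : A →ₐ[O] B}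
    (hf : ∀ x, f (δ π x) = δ π (f x)) (n : ℕ) (x : A) :
    f ((frobInv hA ^ n) x) = (frobInv hB ^ n) (f x) := by
  induction n with
  | zero => rfl
  | succ n ih =>
    refine hB.1 ?_
    rw [← map_frob hf]
    exact (congrArg f (frobHom_frobInv_pow_succ hA n x)).trans
      (ih.trans (frobHom_frobInv_pow_succ hB n (f x)).symm)

theorem map_toAinf (hA : IsPerfectDelta π A) (hB : IsPerfectDelta π B) {f : A →ₐ[O] B}
    (hf : ∀ x, f (δ π x) = δ π (f x)) (hIJ : I ≤ J.comap f) (x : A) :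
    Ainf.map π (Ideal.quotientMapₐ J f hIJ) (toAinf hA I x) = toAinf hB J (f x) := by
  have h : ∀ a, Tilt.map π (Ideal.quotientMapₐ J f hIJ) (toTilt hA I a) = toTilt hB J (f a) := by
    intro a
    refine Subtype.ext (funext fun n => ?_)
    change _ = modPi π (B ⧸ J) (Ideal.Quotient.mkₐ O J ((frobInv hB ^ n) (f a)))
    rw [← map_frobInv_pow hA hB hf]
    rfl
  have h1 := map_wittSection (fun _ => regular_of_injective hB.1) f (map_frob hf) x
  change _ = Witt.map (toTilt hB J) (wittSection π (f x))
  rw [← h1]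
  exact Witt.ext (funext fun i => h _)

end Naturality

end Comparison

/-! ### Transport of perfect prisms along isomorphisms. -/

section Transport

variable {O : Type v} [CommRing O] {π : O} {A B : Type u} [CommRing A]
  [Algebra O A] [DeltaAlgebra π A] [CommRing B] [Algebra O B] [DeltaAlgebra π B] {I : Ideal A}
  {J : Ideal B}

open DeltaAlgebra

theorem IsPerfectDelta.of_algEquiv (hA : IsPerfectDelta π A) (e : A ≃ₐ[O] B)
    (he : ∀ x, e (δ π x) = δ π (e x)) : IsPerfectDelta π B := by
  have h : frob π = e ∘ (frob π : A → A) ∘ e.symm := funext fun x => by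
    have := map_frob (f := (e : A →ₐ[O] B)) he (e.symm x)
    simpa using this.symm
  rw [IsPerfectDelta, h]
  exact e.bijective.comp (hA.comp e.symm.bijective)

variable [IsUniformizer π]

theorem IsLPrism.of_algEquiv (hI : IsLPrism π I) (hA : IsPerfectDelta π A) (e : A ≃ₐ[O] B)
    (he : ∀ x, e (δ π x) = δ π (e x)) (hIJ : ∀ x, e x ∈ J ↔ x ∈ I) : IsLPrism π J := by
  -- With a global regular generator, the Cartier condition transports without comparing
  -- localizations.
  obtain ⟨b, rfl, -, hb⟩ := hI.exists_generator hA
  have hJ : J = (Ideal.span {b}).map (e : A →+* B) := by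
    ext y
    obtain ⟨x, rfl⟩ := e.surjective y
    rw [hIJ]
    refine ⟨fun h => Ideal.mem_map_of_mem _ h, fun h => ?_⟩
    obtain ⟨z, hz, hzx⟩ := (Ideal.mem_map_iff_of_surjective _ e.surjective).1 h
    rwa [← e.injective hzx]
  refine ⟨?_, ?_, ?_⟩
  · rw [hJ, Ideal.map_span, Set.image_singleton]
    refine isCartier_span_singleton ?_
    rw [mem_nonZeroDivisors_iff_right] at hb ⊢
    intro y hy
    obtain ⟨x, rfl⟩ := e.surjective y
    rw [hb x (e.injective (by rw [map_zero, map_mul]; exact hy)), map_zero]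
  · intro f hf
    have : e.symm f ∈ Ideal.span {algebraMap O A π} ⊔ Ideal.span {b} := by
      have h1 : Ideal.span {algebraMap O B π} ⊔ J =
          (Ideal.span {algebraMap O A π} ⊔ Ideal.span {b}).map (e : A →+* B) := by
        rw [Ideal.map_sup, ← hJ, Ideal.map_span, Set.image_singleton]
        simp
      rw [h1] at hf
      obtain ⟨z, hz, rfl⟩ := (Ideal.mem_map_iff_of_surjective _ e.surjective).1 hf
      simpa using hz
    have h1 := hI.isDerivedComplete _ this
    have h2 : (fun (x : ℕ → B) (n : ℕ) => x n - f * x (n + 1)) =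
        Equiv.piCongrRight (fun _ : ℕ => e.toEquiv) ∘
          (fun (x : ℕ → A) (n : ℕ) => x n - e.symm f * x (n + 1)) ∘
          Equiv.piCongrRight (fun _ : ℕ => e.symm.toEquiv) := by
      funext x n
      simp
    rw [h2]
    exact (Equiv.bijective _).comp (h1.comp (Equiv.bijective _))
  · have h1 : J ⊔ Ideal.span (frob π '' J) =
        (Ideal.span {b} ⊔ Ideal.span (frob π '' (Ideal.span {b} : Ideal A))).map
          (e : A →+* B) := by
      rw [Ideal.map_sup, ← hJ, Ideal.map_span, ← Set.image_comp]
      congr 2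
      ext y
      constructor
      · rintro ⟨z, hz, rfl⟩
        obtain ⟨x, rfl⟩ := e.surjective z
        exact ⟨x, (hIJ x).1 hz, map_frob (f := (e : A →ₐ[O] B)) he x⟩
      · rintro ⟨x, hx, rfl⟩
        exact ⟨e x, (hIJ x).2 hx, (map_frob (f := (e : A →ₐ[O] B)) he x).symm⟩
    have h2 := Ideal.mem_map_of_mem (e : A →+* B) hI.uniformizer_mem
    rw [← h1] at h2
    simpa using h2

end Transport

/-! ### The equivalence of categories. -/

section Equivalence

variable {O : Type v} [CommRing O] {π : O} [IsUniformizer π]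

open DeltaAlgebra

theorem PerfectoidAlg.isAdicComplete (R : PerfectoidAlg.{v, u} π) :
    IsAdicComplete (piIdeal π R.obj) R.obj := by
  obtain ⟨P, ⟨e⟩⟩ := R.property
  exact isAdicComplete_of_algEquiv e (P.obj.isPrism.isAdicComplete P.property)

/-- The isomorphism of `A_inf` induced by an isomorphism of algebras. -/
noncomputable def Ainf.mapEquiv {R S : Type u} [CommRing R] [Algebra O R] [CommRing S] [Algebra O S]
    (e : R ≃ₐ[O] S) : Ainf π R ≃ₐ[O] Ainf π S :=
  AlgEquiv.ofAlgHom (Ainf.map π e) (Ainf.map π e.symm)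
    (by rw [← Ainf.map_comp, AlgEquiv.comp_symm, Ainf.map_id])
    (by rw [← Ainf.map_comp, AlgEquiv.symm_comp, Ainf.map_id])

theorem theta_surjective (R : PerfectoidAlg.{v, u} π) :
    Function.Surjective (theta R.isAdicComplete) := by
  intro r
  obtain ⟨P, ⟨e⟩⟩ := R.property
  obtain ⟨a, ha⟩ := Ideal.Quotient.mk_surjective (e.symm r)
  refine ⟨Ainf.map π (e : _ →ₐ[O] R.obj) (toAinf P.property P.obj.ideal a), ?_⟩
  rw [theta_map (P.obj.isPrism.isAdicComplete P.property), theta_toAinf, ha]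
  exact e.apply_symm_apply r

theorem Ainf.map_delta {R S : Type u} [CommRing R] [Algebra O R] [CommRing S] [Algebra O S]
    (f : R →ₐ[O] S) (x : Ainf π R) : Ainf.map π f (δ π x) = δ π (Ainf.map π f x) :=
  Witt.mapFun_delta _ _

/-- The prism axioms for ker θ are not checked directly: the isomorphism A ≅ A_inf(A / I) ≅ A_inf(R)
respects δ and matches I with ker θ. -/
theorem isLPrism_ker_theta_of_algEquiv {A R : Type u} [CommRing A] [Algebra O A]
    [DeltaAlgebra π A] {I : Ideal A} [CommRing R] [Algebra O R] (hA : IsPerfectDelta π A)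
    (hI : IsLPrism π I) (e : (A ⧸ I) ≃ₐ[O] R) (hR : IsAdicComplete (piIdeal π R) R) :
    IsLPrism π (RingHom.ker (theta hR)) ∧ IsPerfectDelta π (Ainf π R) := by
  let E : A ≃ₐ[O] Ainf π R :=
    (AlgEquiv.ofBijective _ (toAinf_bijective hA hI)).trans (Ainf.mapEquiv e)
  have hE' : ∀ x, E x = Ainf.map π (e : _ →ₐ[O] R) (toAinf hA I x) := fun _ => rfl
  have hE : ∀ x, E (δ π x) = δ π (E x) := fun x => by
    rw [hE', hE', toAinf_delta, Ainf.map_delta]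
  refine ⟨hI.of_algEquiv hA E hE fun x => ?_, hA.of_algEquiv E hE⟩
  have h : theta hR (E x) = e (Ideal.Quotient.mk I x) := by
    rw [hE', theta_map (hI.isAdicComplete hA), theta_toAinf]
    rfl
  rw [RingHom.mem_ker, h, map_eq_zero_iff e e.injective, Ideal.Quotient.eq_zero_iff_mem]

theorem isLPrism_ker_theta (R : PerfectoidAlg.{v, u} π) :
    IsLPrism π (RingHom.ker (theta R.isAdicComplete)) ∧ IsPerfectDelta π (Ainf π R.obj) := by
  obtain ⟨P, ⟨e⟩⟩ := R.property
  exact isLPrism_ker_theta_of_algEquiv P.property P.obj.isPrism e _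

/-- An isomorphism of prisms from an isomorphism of `δ_L`-algebras matching the ideals. -/
def LPrism.isoOfAlgEquiv {P Q : LPrism.{v, u} π} (e : P.carrier ≃ₐ[O] Q.carrier)
    (he : ∀ x, e (δ π x) = δ π (e x)) (hI : ∀ x, e x ∈ Q.ideal ↔ x ∈ P.ideal) : P ≅ Q where
  hom := ⟨e, he, fun x hx => (hI x).2 hx⟩
  inv := ⟨e.symm, fun x => e.injective (by
      change e (e.symm _) = e (δ π (e.symm x))
      rw [he, e.apply_symm_apply, e.apply_symm_apply]), fun x hx => (hI _).1 (by
      change e (e.symm x) ∈ _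
      rwa [e.apply_symm_apply])⟩
  hom_inv_id := LPrism.Hom.ext (AlgHom.ext e.symm_apply_apply)
  inv_hom_id := LPrism.Hom.ext (AlgHom.ext e.apply_symm_apply)

variable (π) in
/-- The unit `(A, I) ≅ (A_inf(A / I), ker θ)`. -/
noncomputable def unitIso : 𝟭 (PerfectLPrism.{v, u} π) ≅
    quotFunctor π ⋙ ainfFunctor PerfectoidAlg.isAdicComplete isLPrism_ker_theta :=
  NatIso.ofComponents
    (fun P => ObjectProperty.isoMk _ (LPrism.isoOfAlgEquiv
      (Q := ((quotFunctor π ⋙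
        ainfFunctor PerfectoidAlg.isAdicComplete isLPrism_ker_theta).obj P).obj)
      (AlgEquiv.ofBijective _ (toAinf_bijective P.property P.obj.isPrism))
      (toAinf_delta P.property P.obj.ideal)
      (toAinf_mem_ker_theta_iff P.property _)))
    fun {P Q} f => ObjectProperty.hom_ext _ (LPrism.Hom.ext (AlgHom.ext fun x =>
      (map_toAinf P.property Q.property f.hom.map_δ f.hom.map_ideal x).symm))

variable (π) in
/-- The counit `A_inf(R) / ker θ ≅ R`. -/
noncomputable def counitIso :
    ainfFunctor PerfectoidAlg.isAdicComplete isLPrism_ker_theta ⋙ quotFunctor π ≅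
      𝟭 (PerfectoidAlg.{v, u} π) :=
  NatIso.ofComponents
    (fun R => ObjectProperty.isoMk _ (CommAlgCat.isoMk
      (Ideal.quotientKerAlgEquivOfSurjective (theta_surjective R))))
    fun {R S} f => ObjectProperty.hom_ext _ (CommAlgCat.hom_ext (Ideal.Quotient.algHom_ext O
      (AlgHom.ext fun x => theta_map R.isAdicComplete S.isAdicComplete f.hom.hom x)))

end Equivalence

end LTypical

theorem mainTheorem5 (p : ℕ) [Fact p.Prime] (L : Type v) [Field L] [Algebra ℚ_[p] L]
    [FiniteDimensional ℚ_[p] L] [Algebra ℤ_[p] L] [IsScalarTower ℤ_[p] ℚ_[p] L]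
    (π : LTypical.RingOfIntegers p L) [Fact (Ideal.span {π}).IsMaximal] :
    (LTypical.quotFunctor.{v, u} π).IsEquivalence ∧
    ∃ (hc : ∀ R : LTypical.PerfectoidAlg.{v, u} π,
        IsAdicComplete (LTypical.piIdeal π R.obj) R.obj)
      (hp : ∀ R : LTypical.PerfectoidAlg.{v, u} π,
        LTypical.IsLPrism π (RingHom.ker (LTypical.theta (hc R))) ∧
          LTypical.IsPerfectDelta π (LTypical.Ainf π R.obj))
      (η : 𝟭 (LTypical.PerfectLPrism.{v, u} π) ≅
        LTypical.quotFunctor π ⋙ LTypical.ainfFunctor hc hp)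
      (ε : LTypical.ainfFunctor hc hp ⋙ LTypical.quotFunctor π ≅
        𝟭 (LTypical.PerfectoidAlg.{v, u} π)),
      (∀ (P : LTypical.PerfectLPrism.{v, u} π) (a : P.obj.carrier),
        LTypical.theta (hc ((LTypical.quotFunctor π).obj P)) ((η.hom.app P).hom.toAlgHom a) =
          Ideal.Quotient.mk P.obj.ideal a) ∧
      (∀ (R : LTypical.PerfectoidAlg.{v, u} π) (x : LTypical.Ainf π R.obj),
        (ε.hom.app R).hom.hom
          (Ideal.Quotient.mk (RingHom.ker (LTypical.theta (hc R))) x) =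
            LTypical.theta (hc R) x) := by
  refine ⟨Functor.IsEquivalence.mk' _ (LTypical.unitIso π) (LTypical.counitIso π),
    LTypical.PerfectoidAlg.isAdicComplete, LTypical.isLPrism_ker_theta, LTypical.unitIso π,
    LTypical.counitIso π, fun P a => ?_, fun R x => rfl⟩
  exact LTypical.theta_toAinf P.property _ a
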